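/- Let $\mathcal{A}$ be a finite set of linear hyperplanes in $V=\mathbb{C}^\ell$ (a central simple arrangement), nonempty if $\ell>0$. Let $R=\mathbb{C}[x_1,\dots,x_\ell]$, let $\alpha_H$ be a linear form defining $H\in\mathcal{A}$, and put $f=\prod_{H\in\mathcal{A}}\alpha_H$. Let $\Omega^p_V$ be the $R$-module of polynomial $p$-forms on $V$. The module of logarithmic $p$-forms is $$\Omega^p(\mathcal{A})=\Big\{\omega\in\tfrac1f\Omega^p_V \;\Big|\; \tfrac{d\alpha_H}{\alpha_H}\wedge\omega\in\tfrac1f\Omega^{p+1}_V\ \text{ for all } H\in\mathcal{A}\Big\},$$ and $\Omega^p_0(\mathcal{A})=\{\omega\in\Omega^p(\mathcal{A})\mid \iota_\chi\omega=0\}$ is the kernel of contraction with the Euler field $\chi=\sum_i x_i\partial_i$. The arrangement $\mathcal{A}$ is tame if $\operatorname{pd}_R\Omega^p(\mathcal{A})\le p$ for $0\le p\le\ell$. Its non-free locus is the set of points of $\operatorname{Spec}R$ at which the localization of $\Omega^1(\mathcal{A})$ is not free; its codimension is the minimal height of the corresponding prime ideals ($\infty$ if the locus is empty). Let $k\ge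 0$ be an integer. If $\mathcal{A}$ is tame and its non-free locus has codimension $>k$, then for all $0\le p<k$ the exterior product induces isomorphisms of $R$-modules $$\textstyle\bigwedge^p_R\Omega^1_0(\mathcal{A})\;\xrightarrow{\ \cong\ }\;\Omega^p_0(\mathcal{A})\qquad\text{and}\qquad \bigwedge^p_R\Omega^1(\mathcal{A})\;\xrightarrow{\ \cong\ }\;\Omega^p(\mathcal{A}).$$ -/

import Mathlib

noncomputable section

/-- A central simple arrangement of hyperplanes in `V = ℂ^ℓ`: the hyperplanes are the kernels of
finitely many nonzero linear forms `α_H ∈ V*`, one form for each hyperplane `H`. -/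
structure CentralArrangement (ℓ : ℕ) where
  /-- The chosen defining equations `α_H`, `H ∈ 𝓐`. -/
  forms : Finset (Module.Dual ℂ (Fin ℓ → ℂ))
  form_ne_zero : ∀ α ∈ forms, α ≠ 0
  ker_injOn : ∀ α ∈ forms, ∀ β ∈ forms, LinearMap.ker α = LinearMap.ker β → α = β

/-- The coordinate ring `R = Sym(V*) = ℂ[x₁, …, x_ℓ]` of `V = ℂ^ℓ`. -/
abbrev CoordRing (ℓ : ℕ) : Type := MvPolynomial (Fin ℓ) ℂ

/-- The field `K = ℂ(x₁, …, x_ℓ)` of rational functions on `V`. -/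
abbrev RatFun (ℓ : ℕ) : Type := FractionRing (CoordRing ℓ)

/-- Rational `1`-forms `∑ gᵢ dxᵢ` on `V`, written as the vector `(g₁, …, g_ℓ)` of coefficients. -/
abbrev RatOneForms (ℓ : ℕ) : Type := Fin ℓ → RatFun ℓ

/-- Rational differential forms on `V` of all degrees, with the exterior product as
multiplication: the exterior algebra over `K` of the rational `1`-forms. -/
abbrev RatForms (ℓ : ℕ) : Type := ExteriorAlgebra (RatFun ℓ) (RatOneForms ℓ)

/-- The linear form `α ∈ V*` as an element of the coordinate ring. -/
def linearPoly {ℓ : ℕ} (α : Module.Dual ℂ (Fin ℓ → ℂ)) : CoordRing ℓ :=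
  ∑ i, MvPolynomial.C (α (Pi.single i 1)) * MvPolynomial.X i

/-- The total differential `dg = ∑ (∂g/∂xᵢ) dxᵢ` of a polynomial `g`. -/
def differential {ℓ : ℕ} (g : CoordRing ℓ) : RatOneForms ℓ :=
  fun i => algebraMap (CoordRing ℓ) (RatFun ℓ) (MvPolynomial.pderiv i g)

/-- The module `Ω¹_V` of polynomial `1`-forms: the `R`-span of `dx₁, …, dx_ℓ`. -/
def polyOneForms (ℓ : ℕ) : Submodule (CoordRing ℓ) (RatForms ℓ) :=
  Submodule.span (CoordRing ℓ) (Set.range fun i : Fin ℓ =>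
    ExteriorAlgebra.ι (RatFun ℓ) (differential (MvPolynomial.X i : CoordRing ℓ)))

/-- The module `Ω^p_V` of polynomial `p`-forms: the `R`-span of all exterior products of `p`
polynomial `1`-forms (for `p = 0`, this is `R`). -/
def polyForms (ℓ p : ℕ) : Submodule (CoordRing ℓ) (RatForms ℓ) :=
  polyOneForms ℓ ^ p

/-- Contraction `ι_χ` of rational forms with the Euler differential `χ = ∑ xᵢ ∂ᵢ`: the
antiderivation over `K` with `ι_χ (dxᵢ) = xᵢ`. -/
def eulerContraction (ℓ : ℕ) : RatForms ℓ →ₗ[RatFun ℓ] RatForms ℓ :=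
  CliffordAlgebra.contractLeft (Q := (0 : QuadraticForm (RatFun ℓ) (RatOneForms ℓ)))
    (∑ i, algebraMap (CoordRing ℓ) (RatFun ℓ) (MvPolynomial.X i) •
      (LinearMap.proj i : RatOneForms ℓ →ₗ[RatFun ℓ] RatFun ℓ))

namespace CentralArrangement

variable {ℓ : ℕ} (A : CentralArrangement ℓ)

/-- The reduced defining equation `f = ∏_H α_H`. -/
def definingPoly : CoordRing ℓ := ∏ α ∈ A.forms, linearPoly α

/-- The module `(1/f) Ω^p_V` of rational `p`-forms `ω` with `f ω ∈ Ω^p_V`. -/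
def simplePoleForms (p : ℕ) : Submodule (CoordRing ℓ) (RatForms ℓ) :=
  (polyForms ℓ p).comap (LinearMap.lsmul (CoordRing ℓ) (RatForms ℓ) A.definingPoly)

/-- The rational `1`-form `dα / α` of a linear form `α`. -/
def dlog (α : Module.Dual ℂ (Fin ℓ → ℂ)) : RatForms ℓ :=
  ExteriorAlgebra.ι (RatFun ℓ)
    ((algebraMap (CoordRing ℓ) (RatFun ℓ) (linearPoly α))⁻¹ • differential (linearPoly α))

/-- The module `Ω^p(𝓐)` of logarithmic `p`-forms along `𝓐`: all `ω ∈ (1/f) Ω^p_V` such that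
`(dα_H / α_H) ∧ ω ∈ (1/f) Ω^{p+1}_V` for every hyperplane `H`. -/
def logForms (p : ℕ) : Submodule (CoordRing ℓ) (RatForms ℓ) :=
  A.simplePoleForms p ⊓
    ⨅ α ∈ A.forms, (A.simplePoleForms (p + 1)).comap
      (LinearMap.mulLeft (CoordRing ℓ) (dlog α))

/-- The module `Ω^p₀(𝓐)` of relative logarithmic `p`-forms: the kernel of `ι_χ` on `Ω^p(𝓐)`. -/
def relLogForms (p : ℕ) : Submodule (CoordRing ℓ) (RatForms ℓ) :=
  A.logForms p ⊓ LinearMap.ker ((eulerContraction ℓ).restrictScalars (CoordRing ℓ))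

/-- `𝓐` is tame if `pd_R Ω^p(𝓐) ≤ p` for `0 ≤ p ≤ ℓ`. -/
def IsTame : Prop :=
  ∀ p ≤ ℓ, CategoryTheory.HasProjectiveDimensionLE (ModuleCat.of (CoordRing ℓ) (A.logForms p)) p

/-- The non-free locus of `𝓐`: the points of `Spec R` at which the localization of `Ω¹(𝓐)` is not
a free module. -/
def nonFreeLocus : Set (PrimeSpectrum (CoordRing ℓ)) :=
  (Module.freeLocus (CoordRing ℓ) (A.logForms 1))ᶜ

end CentralArrangement

/-- The codimension of a (closed) subset `Z` of `Spec R`: the least height of a prime ideal in `Z`,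
and `∞` if `Z` is empty. -/
def specCodim {R : Type*} [CommRing R] (Z : Set (PrimeSpectrum R)) : ℕ∞ :=
  ⨅ P ∈ Z, P.asIdeal.height

lemma linearPoly_ne_zero {ℓ : ℕ} {α : Module.Dual ℂ (Fin ℓ → ℂ)} (h : α ≠ 0) :
    linearPoly α ≠ 0 := by
  intro h0
  apply h
  ext i
  have h1 := congrArg (MvPolynomial.eval (Pi.single i (1 : ℂ))) h0
  simpa [linearPoly, Pi.single_apply] using h1

lemma polyOneForms_mul_self {ℓ : ℕ} {x : RatForms ℓ} (hx : x ∈ polyOneForms ℓ) : x * x = 0 := by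
  have h : polyOneForms ℓ ≤
      (LinearMap.range (ExteriorAlgebra.ι (RatFun ℓ) (M := RatOneForms ℓ))).restrictScalars
        (CoordRing ℓ) := by
    rw [polyOneForms, Submodule.span_le]
    rintro _ ⟨i, rfl⟩
    exact ⟨_, rfl⟩
  obtain ⟨w, rfl⟩ := h hx
  exact ExteriorAlgebra.ι_sq_zero w

namespace CentralArrangement

variable {ℓ : ℕ} (A : CentralArrangement ℓ)

lemma definingPoly_ne_zero : A.definingPoly ≠ 0 :=
  Finset.prod_ne_zero_iff.2 fun α hα => linearPoly_ne_zero (A.form_ne_zero α hα)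

lemma logForms_one_mul_self {x : RatForms ℓ} (hx : x ∈ A.logForms 1) : x * x = 0 := by
  have h1 : A.definingPoly • x ∈ polyOneForms ℓ := by
    have h2 : A.definingPoly • x ∈ polyForms ℓ 1 := hx.1
    rwa [polyForms, pow_one] at h2
  have h3 := polyOneForms_mul_self h1
  rw [smul_mul_smul_comm, ← IsScalarTower.algebraMap_smul (RatFun ℓ)] at h3
  refine (smul_eq_zero.1 h3).resolve_left ?_
  simpa using A.definingPoly_ne_zero

lemma relLogForms_one_mul_self {x : RatForms ℓ} (hx : x ∈ A.relLogForms 1) : x * x = 0 :=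
  A.logForms_one_mul_self hx.1

end CentralArrangement

/-- For an `R`-module `N` of rational forms of degree one, the map `⋀^p_R N → RatForms ℓ` induced
by the exterior product, `ω₁ ∧ ⋯ ∧ ω_p ↦ ω₁ ⋯ ω_p` (the inclusion of `R` for `p = 0`). -/
def wedgeMap {ℓ : ℕ} (N : Submodule (CoordRing ℓ) (RatForms ℓ)) (hN : ∀ x ∈ N, x * x = 0) (p : ℕ) :
    ⋀[CoordRing ℓ]^p N →ₗ[CoordRing ℓ] RatForms ℓ :=
  (ExteriorAlgebra.lift (CoordRing ℓ)
    ⟨N.subtype, fun x => hN x x.2⟩).toLinearMap ∘ₗ (⋀[CoordRing ℓ]^p N).subtype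

namespace CentralArrangement

variable {ℓ : ℕ} (A : CentralArrangement ℓ)

/-- The canonical map `j_p : ⋀^p Ω¹(𝓐) → Ω^p(𝓐)`, with values in all rational forms. -/
def logWedge (p : ℕ) : ⋀[CoordRing ℓ]^p (A.logForms 1) →ₗ[CoordRing ℓ] RatForms ℓ :=
  wedgeMap (A.logForms 1) (fun _ hx => A.logForms_one_mul_self hx) p

/-- The canonical map `⋀^p Ω¹₀(𝓐) → Ω^p₀(𝓐)`, with values in all rational forms. -/
def relLogWedge (p : ℕ) : ⋀[CoordRing ℓ]^p (A.relLogForms 1) →ₗ[CoordRing ℓ] RatForms ℓ :=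
  wedgeMap (A.relLogForms 1) (fun _ hx => A.relLogForms_one_mul_self hx) p

end CentralArrangement

end

/-! Write M for Ω¹(𝓐). Tameness gives pd M ≤ 1, so M = P / R^s with P finite projective. Let I be
the ideal of all a such that a·id_M lifts to P (`liftIdeal`). Where M is free the presentation
splits locally, so V(I) lies in the non-free locus and every prime over I has height at least k + 1.
Since R is Cohen–Macaulay, I contains a weakly regular sequence of length k + 1
(`MvPolynomial.exists_isWeaklyRegular_of_le_height`).

Dividing P by the s relations one at a time gives sequences 0 → ⋀^p(N/Rv) → ⋀^(p+1) N →
⋀^(p+1)(N/Rv) → 0, which are exact because the ⋀^p on the left has no I-torsion. Each step in p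
costs one unit of depth, so ⋀^p M has I-depth at least k + 1 - p
(`ExtDepth.exteriorPower_of_presentation`), hence at least 2 for p < k.

An element a of I factors a·id_M as M → R^n → M. The first map extends to Ω^p(𝓐) → ⋀^p R^n: along a
generic point of each hyperplane every logarithmic form is a combination of products of logarithmic
1-forms, and integrality over a UFD can be tested at prime elements. Hence a^p kills kernel and
cokernel of ⋀^p M → Ω^p(𝓐), and depth 2 makes both vanish (`injective_and_range_eq_of_factor`).

The relative statement follows from the splitting Ω¹(𝓐) = Ω¹₀(𝓐) ⊕ R·dα/α, valid for any hyperplane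
because ι_χ(dα/α) = 1. -/

noncomputable section

/-! ### Depth with respect to an ideal, measured by Ext -/

open CategoryTheory Abelian RingTheory.Sequence Pointwise

universe u

/-- `Ext`-depth: `Extⁱ_R(R/I, N) = 0` for all `i < n`. -/
def ExtDepth {R : Type u} [CommRing R] (I : Ideal R) (N : Type u) [AddCommGroup N] [Module R N]
    (n : ℕ) : Prop :=
  ∀ i < n, Subsingleton (Ext (ModuleCat.of R (R ⧸ I)) (ModuleCat.of R N) i)

namespace ExtDepth

variable {R : Type u} [CommRing R] {I : Ideal R} {N N' N'' : Type u} [AddCommGroup N] [Module R N]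
  [AddCommGroup N'] [Module R N'] [AddCommGroup N''] [Module R N''] {n : ℕ}

lemma mono {m : ℕ} (h : ExtDepth I N n) (hmn : m ≤ n) : ExtDepth I N m :=
  fun i hi => h i (hi.trans_le hmn)

lemma shortExact {f : N' →ₗ[R] N} {g : N →ₗ[R] N''} (hf : Function.Injective f)
    (hfg : Function.Exact f g) (hg : Function.Surjective g) :
    (ModuleCat.shortComplexOfCompEqZero f g hfg.linearMap_comp_eq_zero).ShortExact where
  exact := ModuleCat.shortComplex_exact _ hfg
  mono_f := (ModuleCat.mono_iff_injective _).2 hf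
  epi_g := (ModuleCat.epi_iff_surjective _).2 hg

/-- In the long exact sequence Extⁱ(R/I, N'') lies between Extⁱ(R/I, N) and Extⁱ⁺¹(R/I, N'). Hence
the submodule needs one more unit of depth than the quotient inherits. -/
lemma right_of_exact {f : N' →ₗ[R] N} {g : N →ₗ[R] N''} (hf : Function.Injective f)
    (hfg : Function.Exact f g) (hg : Function.Surjective g)
    (h' : ExtDepth I N' (n + 1)) (h : ExtDepth I N n) : ExtDepth I N'' n := by
  intro i hi
  have zero1 := AddCommGrpCat.isZero_of_iff_subsingleton.mpr (h i hi)
  have zero2 := AddCommGrpCat.isZero_of_iff_subsingleton.mpr (h' (i + 1) (by omega))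
  exact AddCommGrpCat.subsingleton_of_isZero <| ShortComplex.Exact.isZero_of_both_zeros
    ((Ext.covariant_sequence_exact₃' _ (shortExact hf hfg hg)) i (i + 1) rfl)
    (zero1.eq_zero_of_src _) (zero2.eq_zero_of_tgt _)

lemma middle_of_exact {f : N' →ₗ[R] N} {g : N →ₗ[R] N''} (hf : Function.Injective f)
    (hfg : Function.Exact f g) (hg : Function.Surjective g)
    (h' : ExtDepth I N' n) (h'' : ExtDepth I N'' n) : ExtDepth I N n := by
  intro i hi
  have zero1 := AddCommGrpCat.isZero_of_iff_subsingleton.mpr (h' i hi)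
  have zero2 := AddCommGrpCat.isZero_of_iff_subsingleton.mpr (h'' i hi)
  exact AddCommGrpCat.subsingleton_of_isZero <| ShortComplex.Exact.isZero_of_both_zeros
    ((Ext.covariant_sequence_exact₂' _ (shortExact hf hfg hg)) i)
    (zero1.eq_zero_of_src _) (zero2.eq_zero_of_tgt _)

lemma of_retract (f : N' →ₗ[R] N) (g : N →ₗ[R] N') (hgf : g ∘ₗ f = .id)
    (h : ExtDepth I N n) : ExtDepth I N' n := by
  intro i hi
  have := h i hi
  refine ⟨fun x y => ?_⟩
  have key : ∀ z : Ext (ModuleCat.of R (R ⧸ I)) (ModuleCat.of R N') i, z = 0 := by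
    intro z
    have h1 : (z.comp (Ext.mk₀ (ModuleCat.ofHom f)) (add_zero i)).comp
        (Ext.mk₀ (ModuleCat.ofHom g)) (add_zero i) = z := by
      rw [Ext.comp_assoc_of_third_deg_zero, Ext.mk₀_comp_mk₀, ← ModuleCat.ofHom_comp, hgf]
      exact Ext.comp_mk₀_id z
    rw [← h1, Subsingleton.elim (z.comp (Ext.mk₀ (ModuleCat.ofHom f)) (add_zero i)) 0,
      Ext.zero_comp]
  rw [key x, key y]

lemma of_equiv (e : N ≃ₗ[R] N') (h : ExtDepth I N n) : ExtDepth I N' n :=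
  h.of_retract e.symm.toLinearMap e.toLinearMap (by ext; simp)

lemma of_subsingleton [Subsingleton N] : ExtDepth I N n := by
  intro i _
  refine ⟨fun x y => ?_⟩
  have key : ∀ z : Ext (ModuleCat.of R (R ⧸ I)) (ModuleCat.of R N) i, z = 0 := by
    intro z
    have : z.comp (Ext.mk₀ (𝟙 (ModuleCat.of R N))) (add_zero i) = z := Ext.comp_mk₀_id z
    rw [← this, (ModuleCat.isZero_of_subsingleton (ModuleCat.of R N)).eq_of_src (𝟙 _) 0,
      Ext.mk₀_zero, Ext.comp_zero]
  rw [key x, key y]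

lemma pi_fin (h : ExtDepth I R n) (m : ℕ) : ExtDepth I (Fin m → R) n := by
  induction m with
  | zero => exact of_subsingleton
  | succ m ih =>
    have h2 : ExtDepth I (R × (Fin m → R)) n :=
      middle_of_exact (f := LinearMap.inl R R (Fin m → R)) (g := LinearMap.snd R R (Fin m → R))
        LinearMap.inl_injective .inl_snd LinearMap.snd_surjective h ih
    exact h2.of_equiv (Fin.consLinearEquiv R (fun _ : Fin (m + 1) => R))

lemma of_projective (h : ExtDepth I R n) [Module.Finite R N] [Module.Projective R N] :
    ExtDepth I N n := by
  obtain ⟨m, f, g, -, -, hfg⟩ := Module.Finite.exists_comp_eq_id_of_projective R N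
  exact (h.pi_fin m).of_retract g f hfg

/-- Ext⁰(R/I, N) is Hom(R/I, N), the I-torsion of N. -/
lemma one_iff : ExtDepth I N 1 ↔ ∀ x : N, (∀ a ∈ I, a • x = 0) → x = 0 := by
  have h1 : ExtDepth I N 1 ↔ Subsingleton ((R ⧸ I) →ₗ[R] N) := by
    have e := (Ext.addEquiv₀ (X := ModuleCat.of R (R ⧸ I)) (Y := ModuleCat.of R N)).trans
      ModuleCat.homAddEquiv
    refine ⟨fun h => e.symm.toEquiv.subsingleton_congr.2 (h 0 one_pos), fun h i hi => ?_⟩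
    obtain rfl : i = 0 := by omega
    exact e.toEquiv.subsingleton_congr.2 h
  rw [h1]
  constructor
  · intro h x hx
    have h2 : I ≤ LinearMap.ker (LinearMap.toSpanSingleton R N x) :=
      fun a ha => by simpa using hx a ha
    have h3 := LinearMap.congr_fun (Subsingleton.elim (Submodule.liftQ I _ h2) 0)
      (Submodule.Quotient.mk 1)
    rw [Submodule.liftQ_apply] at h3
    simpa using h3
  · intro h
    refine ⟨fun φ ψ => ?_⟩
    have h2 : ∀ y : R ⧸ I, (φ - ψ) y = 0 := by
      intro y
      refine h _ fun a ha => ?_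
      obtain ⟨b, rfl⟩ := Submodule.Quotient.mk_surjective _ y
      rw [← map_smul, ← Submodule.Quotient.mk_smul, (Submodule.Quotient.mk_eq_zero I).2, map_zero]
      exact I.mul_mem_right b ha
    ext
    exact sub_eq_zero.1 (h2 _)

lemma eq_zero_of_pow (h : ExtDepth I N 1) {m : ℕ} {x : N} (hx : ∀ a ∈ I ^ m, a • x = 0) :
    x = 0 := by
  induction m generalizing x with
  | zero => simpa using hx 1 (by simp)
  | succ m ih =>
    refine ih fun a ha => one_iff.1 h _ fun b hb => ?_
    rw [smul_smul]
    exact hx _ (by rw [pow_succ']; exact Ideal.mul_mem_mul hb ha)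

/-- If N has depth 2 and the ambient W has no I-torsion, then W/N has no I-torsion either, so the
class of x vanishes. This yields surjectivity onto the logarithmic forms. -/
lemma mem_of_pow_smul_mem {W : Type u} [AddCommGroup W] [Module R W] {N : Submodule R W}
    (hW : ∀ x : W, (∀ a ∈ I, a • x = 0) → x = 0) (h : ExtDepth I N 2) {m : ℕ} {x : W}
    (hx : ∀ a ∈ I ^ m, a • x ∈ N) : x ∈ N := by
  have h1 : ExtDepth I (W ⧸ N) 1 :=
    right_of_exact (f := N.subtype) (g := N.mkQ) N.subtype_injective
      (LinearMap.exact_subtype_mkQ N) N.mkQ_surjective h (one_iff.2 hW)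
  rw [← Submodule.Quotient.mk_eq_zero]
  refine h1.eq_zero_of_pow (m := m) fun a ha => ?_
  rw [← Submodule.Quotient.mk_smul, Submodule.Quotient.mk_eq_zero]
  exact hx a ha

/-- Multiplication by the first element a on Extⁱ⁺¹(R/I, N) is injective, since Extⁱ(R/I, N/aN) = 0
by induction, and it is zero, since a kills R/I. -/
lemma of_isWeaklyRegular (rs : List R) (mem : ∀ r ∈ rs, r ∈ I) (reg : IsWeaklyRegular N rs) :
    ExtDepth I N rs.length := by
  induction rs generalizing N with
  | nil => intro i hi; simp at hi
  | cons a rs ih =>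
    rw [isWeaklyRegular_cons_iff] at reg
    simp only [List.mem_cons, forall_eq_or_imp] at mem
    have ih' := ih mem.2 reg.2
    intro i hi
    rw [List.length_cons] at hi
    obtain _ | i := i
    · refine (one_iff.2 fun x hx => ?_) 0 one_pos
      exact reg.1.right_eq_zero_of_smul (hx a mem.1)
    · let g := (AddCommGrpCat.ofHom ((Ext.mk₀ ((ModuleCat.of R N).smulShortComplex a).f).postcomp
        (ModuleCat.of R (R ⧸ I)) (add_zero (i + 1))))
      have mono_g : Mono g := by
        apply (Ext.covariant_sequence_exact₁' (ModuleCat.of R (R ⧸ I))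
          (IsSMulRegular.smulShortComplex_shortExact (M := ModuleCat.of R N) reg.1) i (i + 1)
          rfl).mono_g ((AddCommGrpCat.isZero_of_iff_subsingleton.mpr ?_).eq_zero_of_src _)
        exact ih' i (by omega)
      have zero_g : g = 0 := by
        refine Ext.postcomp_smul_id_eq_zero_of_mem_annihilator ?_ (i + 1)
        show a ∈ Module.annihilator R (R ⧸ I)
        rw [Ideal.annihilator_quotient]
        exact mem.1
      exact AddCommGrpCat.subsingleton_of_isZero (Limits.IsZero.of_mono_eq_zero _ zero_g)

end ExtDepth

end

/-! ### Nagata's change of variables -/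

noncomputable section

section NagataChange

open Polynomial MvPolynomial

variable {k : Type*} [Field k] {n : ℕ}

/-- Nagata's substitution `X_i ↦ X_i + c X_0 ^ (U ^ i)` for `i ≠ 0`, `X_0 ↦ X_0`. -/
def nagataHom (U : ℕ) (c : k) :
    MvPolynomial (Fin (n + 1)) k →ₐ[k] MvPolynomial (Fin (n + 1)) k :=
  MvPolynomial.aeval fun i ↦
    if i = 0 then MvPolynomial.X 0 else MvPolynomial.X i + c • MvPolynomial.X 0 ^ U ^ i.1

lemma nagataHom_comp_neg (U : ℕ) (c : k) :
    (nagataHom (n := n) U c).comp (nagataHom U (-c)) = AlgHom.id _ _ := by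
  unfold nagataHom
  rw [comp_aeval, ← MvPolynomial.aeval_X_left]
  ext i v
  cases i using Fin.cases <;> simp

/-- Nagata's substitution as an automorphism of the polynomial ring. -/
def nagataEquiv (k : Type*) [Field k] (n U : ℕ) :
    MvPolynomial (Fin (n + 1)) k ≃ₐ[k] MvPolynomial (Fin (n + 1)) k :=
  AlgEquiv.ofAlgHom (nagataHom U 1) (nagataHom U (-1))
    (nagataHom_comp_neg U 1) (by simpa using nagataHom_comp_neg U (-1 : k))

lemma nagataEquiv_apply (U : ℕ) (f : MvPolynomial (Fin (n + 1)) k) :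
    nagataEquiv k n U f = nagataHom U 1 f := rfl

lemma finSuccEquiv_nagata_X_zero (U : ℕ) :
    finSuccEquiv k n (nagataEquiv k n U (MvPolynomial.X 0)) = Polynomial.X := by
  simp [nagataEquiv_apply, nagataHom, finSuccEquiv_X_zero]

lemma finSuccEquiv_nagata_X_succ (U : ℕ) (i : Fin n) :
    finSuccEquiv k n (nagataEquiv k n U (MvPolynomial.X i.succ)) =
      Polynomial.X ^ U ^ (i.1 + 1) + Polynomial.C (MvPolynomial.X i) := by
  simp [nagataEquiv_apply, nagataHom, finSuccEquiv_X_zero, finSuccEquiv_X_succ, add_comm]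

lemma finSuccEquiv_nagata_monomial (U : ℕ) (v : Fin (n + 1) →₀ ℕ) (a : k) :
    finSuccEquiv k n (nagataEquiv k n U (MvPolynomial.monomial v a)) =
      Polynomial.C (MvPolynomial.C a) * (Polynomial.X ^ v 0 *
        ∏ i : Fin n, (Polynomial.X ^ U ^ (i.1 + 1) + Polynomial.C (MvPolynomial.X i)) ^ v i.succ) := by
  rw [MvPolynomial.monomial_eq, Finsupp.prod_fintype _ _ (fun _ => pow_zero _), map_mul, map_mul,
    Fin.prod_univ_succ]
  simp only [map_mul, map_prod, map_pow, finSuccEquiv_nagata_X_zero, finSuccEquiv_nagata_X_succ]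
  congr 1
  rw [← MvPolynomial.algebraMap_eq, AlgEquiv.commutes, AlgEquiv.commutes]
  rfl

lemma nagata_monic (U : ℕ) (hU : 0 < U) (v : Fin (n + 1) →₀ ℕ) :
    (Polynomial.X ^ v 0 * ∏ i : Fin n, (Polynomial.X ^ U ^ (i.1 + 1) +
      Polynomial.C (MvPolynomial.X i : MvPolynomial (Fin n) k)) ^ v i.succ).Monic :=
  (monic_X_pow _).mul (monic_prod_of_monic _ _ fun _ _ =>
    (monic_X_pow_add_C _ (pow_pos hU _).ne').pow _)

/-- The variable of index i acquires degree U^i, so the degree of a monomial is the number whose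
base-U digits are its exponents, provided these are below U. -/
lemma natDegree_finSuccEquiv_nagata_monomial {U : ℕ} (hU : 0 < U) (v : Fin (n + 1) →₀ ℕ) {a : k}
    (ha : a ≠ 0) :
    (finSuccEquiv k n (nagataEquiv k n U (MvPolynomial.monomial v a))).natDegree =
      ∑ i : Fin (n + 1), U ^ i.1 * v i := by
  rw [finSuccEquiv_nagata_monomial, natDegree_C_mul (by simpa using ha),
    (monic_X_pow _).natDegree_mul (monic_prod_of_monic _ _ fun _ _ =>
      (monic_X_pow_add_C _ (pow_pos hU _).ne').pow _),
    natDegree_prod_of_monic _ _ (fun i _ => (monic_X_pow_add_C _ (pow_pos hU _).ne').pow _),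
    Fin.sum_univ_succ]
  simp [mul_comm]

lemma leadingCoeff_finSuccEquiv_nagata_monomial {U : ℕ} (hU : 0 < U) (v : Fin (n + 1) →₀ ℕ)
    (a : k) :
    (finSuccEquiv k n (nagataEquiv k n U (MvPolynomial.monomial v a))).leadingCoeff =
      MvPolynomial.C a := by
  rw [finSuccEquiv_nagata_monomial, leadingCoeff_mul, (nagata_monic U hU v).leadingCoeff, mul_one,
    leadingCoeff_C]

lemma sum_pow_mul_ne {U : ℕ} (hU : 1 < U) {v w : Fin (n + 1) →₀ ℕ} (hv : ∀ i, v i < U)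
    (hw : ∀ i, w i < U) (ne : v ≠ w) :
    ∑ i : Fin (n + 1), U ^ i.1 * v i ≠ ∑ i : Fin (n + 1), U ^ i.1 * w i := by
  intro h
  refine ne <| Finsupp.ext <| congrFun <| List.ofFn_inj.mp ?_
  apply Nat.ofDigits_inj_of_len_eq hU (by simp) (by simpa [List.mem_ofFn] using Fin.forall_fin_succ.1 hv)
    (by simpa [List.mem_ofFn] using Fin.forall_fin_succ.1 hw)
  simpa only [Nat.ofDigits_eq_sum_mapIdx, List.mapIdx_eq_ofFn, List.get_ofFn, List.length_ofFn,
    Fin.val_cast, mul_comm, List.sum_ofFn] using! h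

/-- After Nagata's change of variables, a nonzero polynomial is monic in `X_0` up to a unit. -/
lemma exists_algEquiv_isUnit_leadingCoeff {f : MvPolynomial (Fin (n + 1)) k} (hf : f ≠ 0) :
    ∃ e : MvPolynomial (Fin (n + 1)) k ≃ₐ[k] (MvPolynomial (Fin n) k)[X],
      IsUnit (e f).leadingCoeff := by
  -- U exceeds every exponent occurring in f, and the summand 2 keeps it a valid base (> 1) even for
  -- constant f. Distinct monomials then get distinct degrees, so the top one alone determines the
  -- leading coefficient, a nonzero constant.
  set U := 2 + f.totalDegree with hUdef
  have hU : 0 < U := by omega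
  refine ⟨(nagataEquiv k n U).trans (finSuccEquiv k n), ?_⟩
  simp only [AlgEquiv.trans_apply]
  set h := fun w ↦ finSuccEquiv k n (nagataEquiv k n U (MvPolynomial.monomial w (coeff w f)))
    with hdef
  obtain ⟨v, vin, vs⟩ := Finset.exists_max_image f.support (fun v ↦ (h v).natDegree)
    (support_nonempty.mpr hf)
  have hlt : ∀ w ∈ f.support, ∀ i, w i < U := fun w hw i =>
    lt_of_le_of_lt ((monomial_le_degreeOf i hw).trans (degreeOf_le_totalDegree f i)) (by omega)
  have vs' : ∀ x ∈ f.support \ {v}, (h x).degree < (h v).degree := by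
    intro x hx
    obtain ⟨h1, h2⟩ := Finset.mem_sdiff.mp hx
    apply degree_lt_degree <| lt_of_le_of_ne (vs x h1) ?_
    rw [hdef]
    beta_reduce
    rw [natDegree_finSuccEquiv_nagata_monomial hU _ (MvPolynomial.mem_support_iff.mp h1),
      natDegree_finSuccEquiv_nagata_monomial hU _ (MvPolynomial.mem_support_iff.mp vin)]
    exact sum_pow_mul_ne (by omega) (hlt x h1) (hlt v vin) (by simpa using h2)
  have hv0 : h v ≠ 0 := by
    rw [hdef]
    simpa using MvPolynomial.mem_support_iff.mp vin
  have hsum : finSuccEquiv k n (nagataEquiv k n U f) = ∑ x ∈ f.support \ {v}, h x + h v := by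
    conv_lhs => rw [← f.support_sum_monomial_coeff]
    rw [map_sum, map_sum, Finset.sum_eq_add_sum_sdiff_singleton_of_mem vin, add_comm]
  rw [hsum, leadingCoeff_add_of_degree_lt <| (lt_of_le_of_lt <| degree_sum_le _ _) <|
    (Finset.sup_lt_iff <| Ne.bot_lt (fun x ↦ hv0 <| degree_eq_bot.mp x)).mpr vs', hdef,
    leadingCoeff_finSuccEquiv_nagata_monomial hU]
  exact (MvPolynomial.mem_support_iff.mp vin).isUnit.map MvPolynomial.C

end NagataChange

/-! ### Heights over a monic polynomial and the Cohen–Macaulay property -/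

section Height

open Polynomial RingTheory.Sequence Pointwise

variable {B : Type*} [CommRing B]

/-- If `I ⊆ B[X]` contains a monic polynomial, every prime of `B` over `I ∩ B` lifts to a prime of
`B[X]` over `I`. -/
lemma exists_prime_comap_C_eq {I : Ideal B[X]} {f : B[X]} (hf : f.Monic) (hfI : f ∈ I)
    (Q : Ideal B) [Q.IsPrime] (hQ : I.comap C ≤ Q) :
    ∃ P : Ideal B[X], P.IsPrime ∧ I ≤ P ∧ P.comap C = Q := by
  have hint : Algebra.IsIntegral B (B[X] ⧸ I) := ⟨hf.quotient_isIntegral hfI⟩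
  obtain ⟨P, -, hP, hPQ⟩ := Ideal.exists_ideal_over_prime_of_isIntegral Q (⊥ : Ideal (B[X] ⧸ I))
    (by
      intro b hb
      refine hQ (Ideal.mem_comap.2 (Ideal.Quotient.eq_zero_iff_mem.1 ?_))
      rwa [Ideal.mem_comap, Ideal.mem_bot] at hb)
  refine ⟨P.comap (Ideal.Quotient.mk I), Ideal.comap_isPrime _ _, fun x hx => ?_, ?_⟩
  · rw [Ideal.mem_comap, Ideal.Quotient.eq_zero_iff_mem.2 hx]
    exact P.zero_mem
  · rw [← hPQ, Ideal.comap_comap]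
    rfl

/-- With Q = P ∩ B, it suffices that P/QB[X] has height at most one. By Krull this holds if P is
minimal over QB[X] + (f). A smaller prime J would also contract to Q, and B[X]/J is integral over B
because f is monic, so incomparability gives J = P. -/
lemma height_le_height_comap_C_add_one [IsNoetherianRing B] {f : B[X]} (hf : f.Monic)
    (P : Ideal B[X]) [P.IsPrime] (hfP : f ∈ P) : P.height ≤ (P.comap C).height + 1 := by
  set Q := P.comap C with hQ
  have : P.LiesOver Q := ⟨rfl⟩
  refine (Ideal.height_le_height_add_of_liesOver Q P).trans ?_
  gcongr
  set q := Ideal.Quotient.mk (Q.map (algebraMap B B[X])) with hq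
  have hle : Q.map (algebraMap B B[X]) ≤ P := Ideal.map_comap_le
  have hker : RingHom.ker q ≤ P := by rwa [hq, Ideal.mk_ker]
  have hsurj : Function.Surjective q := Ideal.Quotient.mk_surjective
  refine Ideal.height_le_one_of_isPrincipal_of_mem_minimalPrimes (Ideal.span {q f}) _ ?_
  refine ⟨⟨Ideal.map_isPrime_of_surjective hsurj hker, ?_⟩, ?_⟩
  · rw [Ideal.span_singleton_le_iff_mem]
    exact Ideal.mem_map_of_mem _ hfP
  · rintro P' ⟨hP', hfP'⟩ hle'
    rw [Ideal.span_singleton_le_iff_mem] at hfP'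
    rw [Ideal.map_le_iff_le_comap]
    have h1 : P'.comap q ≤ P := by
      refine (Ideal.comap_mono hle').trans ?_
      rw [Ideal.comap_map_of_surjective _ hsurj, ← RingHom.ker_eq_comap_bot]
      exact sup_le le_rfl hker
    by_contra hne
    obtain ⟨x, hxP, hx⟩ := Set.not_subset.1 hne
    set J := P'.comap q with hJ
    have hJp : J.IsPrime := Ideal.comap_isPrime _ _
    have hfJ : f ∈ J := hfP'
    have hint : Algebra.IsIntegral B (B[X] ⧸ J) := ⟨hf.quotient_isIntegral hfJ⟩
    have hkJ : RingHom.ker (Ideal.Quotient.mk J) ≤ P := by rwa [Ideal.mk_ker]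
    have hPJ : (P.map (Ideal.Quotient.mk J)).IsPrime :=
      Ideal.map_isPrime_of_surjective Ideal.Quotient.mk_surjective hkJ
    have hlt : (⊥ : Ideal (B[X] ⧸ J)) < P.map (Ideal.Quotient.mk J) := by
      refine bot_lt_iff_ne_bot.2 fun h0 => hx ?_
      have := Ideal.mem_map_of_mem (Ideal.Quotient.mk J) hxP
      rw [h0, Ideal.mem_bot, Ideal.Quotient.eq_zero_iff_mem] at this
      exact this
    have h2 := Ideal.IsIntegral.comap_lt_comap (R := B) hlt
    refine h2.not_ge fun b hb => ?_
    have h3 : C b ∈ P := by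
      rw [Ideal.mem_comap] at hb
      have : Ideal.Quotient.mk J (C b) ∈ P.map (Ideal.Quotient.mk J) := hb
      rw [Ideal.mem_map_iff_of_surjective _ Ideal.Quotient.mk_surjective] at this
      obtain ⟨y, hy, hyb⟩ := this
      rw [Ideal.Quotient.mk_eq_mk_iff_sub_mem] at hyb
      have := P.sub_mem hy (h1 hyb)
      simpa using this
    have h4 : C b ∈ J := by
      rw [hJ, Ideal.mem_comap, Ideal.Quotient.eq_zero_iff_mem.2]
      · exact P'.zero_mem
      · exact Ideal.mem_map_of_mem _ h3
    exact Ideal.Quotient.eq_zero_iff_mem.2 h4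

/-- A weakly regular sequence of `B` extends a monic polynomial to a weakly regular sequence of
`B[X]`. -/
lemma isWeaklyRegular_cons_map_C [IsDomain B] {f : B[X]} (hf : f.Monic) {rs : List B}
    (h : IsWeaklyRegular B rs) : IsWeaklyRegular B[X] (f :: rs.map C) := by
  rw [isWeaklyRegular_cons_iff]
  refine ⟨fun x y hxy => mul_left_cancel₀ hf.ne_zero hxy, ?_⟩
  -- B[X]/(f) is free over B, so the sequence stays weakly regular modulo f by flat base change.
  have : Module.Free B (AdjoinRoot f) := hf.free_adjoinRoot
  have h1 := IsWeaklyRegular.of_flat (S := AdjoinRoot f) h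
  have h2 : f • (⊤ : Submodule B[X] B[X]) = Ideal.span {f} := by
    rw [← Submodule.ideal_span_singleton_smul]
    simp
  have e : QuotSMulTop f B[X] ≃ₗ[B[X]] (B[X] ⧸ Ideal.span {f}) := Submodule.quotEquivOfEq _ _ h2
  rw [e.isWeaklyRegular_congr, ← Polynomial.algebraMap_eq]
  rw [isWeaklyRegular_map_algebraMap_iff] at h1 ⊢
  exact h1

/-- Polynomial rings over a field are Cohen–Macaulay: an ideal all of whose primes have height at
least `n` contains a weakly regular sequence of length `n`. -/
theorem MvPolynomial.exists_isWeaklyRegular_of_le_height {k : Type*} [Field k] (m n : ℕ)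
    (I : Ideal (MvPolynomial (Fin m) k)) (hI : ∀ P : Ideal (MvPolynomial (Fin m) k), P.IsPrime →
      I ≤ P → (n : ℕ∞) ≤ P.height) :
    ∃ rs : List (MvPolynomial (Fin m) k), rs.length = n ∧ (∀ r ∈ rs, r ∈ I) ∧
      IsWeaklyRegular (MvPolynomial (Fin m) k) rs := by
  induction m generalizing n with
  | zero =>
    obtain rfl | hn := Nat.eq_zero_or_pos n
    · exact ⟨[], by simp⟩
    have hI1 : I = ⊤ := by
      by_contra hne
      obtain ⟨P, hP, hIP⟩ := Ideal.exists_le_maximal I hne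
      have h1 := hI P hP.isPrime hIP
      have e := (MvPolynomial.isEmptyRingEquiv k (Fin 0))
      have h2 : P = ⊥ := by
        have hf : IsField (MvPolynomial (Fin 0) k) :=
          e.toMulEquiv.isField (Field.toIsField k)
        let := hf.toField
        exact (Ideal.eq_bot_or_top P).resolve_right hP.ne_top
      rw [h2, Ideal.height_bot] at h1
      exact absurd (Nat.cast_le.1 h1) (by omega)
    -- Weak regularity does not require proper quotients, so repeated 1 serves for the unit ideal.
    refine ⟨List.replicate n 1, by simp, by simp [hI1], ?_⟩
    rw [isWeaklyRegular_iff_Fin]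
    intro i x y hxy
    simpa using hxy
  | succ m ih =>
    obtain _ | n := n
    · exact ⟨[], by simp⟩
    have hI0 : I ≠ ⊥ := by
      rintro rfl
      have := hI ⊥ Ideal.isPrime_bot le_rfl
      rw [Ideal.height_bot] at this
      exact absurd (Nat.cast_le.1 this) (by omega)
    obtain ⟨f₀, hf₀I, hf₀⟩ := Submodule.exists_mem_ne_zero_of_ne_bot hI0
    obtain ⟨e, hu⟩ := exists_algEquiv_isUnit_leadingCoeff hf₀
    obtain ⟨f, hf, hfI⟩ : ∃ f : (MvPolynomial (Fin m) k)[X], f.Monic ∧ e.symm f ∈ I := by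
      refine ⟨_, monic_of_isUnit_leadingCoeff_inv_smul hu, ?_⟩
      rw [Units.smul_def, Algebra.smul_def, map_mul, AlgEquiv.symm_apply_apply]
      exact I.mul_mem_left _ hf₀I
    set I' := I.comap e.symm.toRingEquiv.toRingHom with hI'
    have hfI' : f ∈ I' := hfI
    -- Contraction to the coefficient ring lowers heights by at most one, so n elements come from
    -- the induction and f is the remaining one.
    obtain ⟨rs, hlen, hmem, hreg⟩ := ih n (I'.comap Polynomial.C) (by
      intro Q hQ hIQ
      obtain ⟨P, hP, hIP, rfl⟩ := exists_prime_comap_C_eq hf hfI' Q hIQ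
      have h1 := height_le_height_comap_C_add_one hf P (hIP hfI')
      have h2 : ((n + 1 : ℕ) : ℕ∞) ≤ P.height := by
        have h3 : (P.comap e.toRingEquiv).height = P.height :=
          RingEquiv.height_comap e.toRingEquiv P
        rw [← h3]
        refine hI _ (Ideal.comap_isPrime _ _) fun x hx => hIP ?_
        rw [hI', Ideal.mem_comap]
        simpa using hx
      push_cast at h2
      exact (ENat.add_le_add_iff_right (by simp)).1 (h2.trans h1))
    have h1 := isWeaklyRegular_cons_map_C hf hreg
    refine ⟨(f :: rs.map Polynomial.C).map e.symm, by simp [hlen], ?_, ?_⟩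
    · simp only [List.map_cons, List.mem_cons, List.mem_map]
      rintro r (rfl | ⟨_, ⟨b, hb, rfl⟩, rfl⟩)
      · exact hfI
      · exact hmem b hb
    · refine (AddEquiv.isWeaklyRegular_congr (e := e.symm.toAddEquiv) ?_).1 h1
      rw [List.forall₂_map_right_iff, List.forall₂_same]
      intro r _ x
      simp [smul_eq_mul]

end Height

end

/-! ### Exterior powers of a quotient by one vector -/

noncomputable section

namespace ExteriorAlgebra

variable {R : Type*} [CommRing R] {M : Type*} [AddCommGroup M] [Module R M]
  {M' : Type*} [AddCommGroup M'] [Module R M']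

lemma ι_mul_eq_involute_mul_ι (v : M) (x : ExteriorAlgebra R M) :
    ι R v * x = CliffordAlgebra.involute x * ι R v := by
  induction x using ExteriorAlgebra.induction with
  | algebraMap r => rw [AlgHom.commutes, Algebra.commutes]
  | ι m =>
    have : CliffordAlgebra.involute (ι R m) = -ι R m := CliffordAlgebra.involute_ι m
    rw [this, neg_mul]
    exact eq_neg_of_add_eq_zero_left (ι_add_mul_swap v m)
  | mul a b ha hb => rw [map_mul, ← mul_assoc, ha, mul_assoc, hb, mul_assoc]
  | add a b ha hb => rw [map_add, mul_add, add_mul, ha, hb]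

lemma mul_ι_mul_ι_self (y : ExteriorAlgebra R M) (v : M) : y * ι R v * ι R v = 0 := by
  rw [mul_assoc, ι_sq_zero, mul_zero]

/-- The kernel of `⋀ M → ⋀ (M / Rv)` is the ideal generated by `v`. -/
lemma exists_eq_mul_ι_of_map_eq_zero {q : M →ₗ[R] M'} (hq : Function.Surjective q) {v : M}
    (hv : LinearMap.ker q = Submodule.span R {v}) {x : ExteriorAlgebra R M} (hx : map q x = 0) :
    ∃ y, x = y * ι R v := by
  set J : Ideal (ExteriorAlgebra R M) := Ideal.span {ι R v} with hJ
  -- As v commutes with forms up to the grading involution, this left ideal is two-sided. So ⋀M/J is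
  -- an algebra to which M' maps with square zero, and the quotient map factors through `map q`.
  have hJ2 : J.IsTwoSided := by
    refine ⟨fun {a} b ha => ?_⟩
    rw [hJ, Ideal.mem_span_singleton'] at ha ⊢
    obtain ⟨y, rfl⟩ := ha
    exact ⟨y * CliffordAlgebra.involute b, by
      rw [mul_assoc, mul_assoc, ι_mul_eq_involute_mul_ι]⟩
  let g : M →ₗ[R] ExteriorAlgebra R M ⧸ J := (Ideal.Quotient.mkₐ R J).toLinearMap ∘ₗ ι R
  have hg : LinearMap.ker q ≤ LinearMap.ker g := by
    rw [hv, Submodule.span_singleton_le_iff_mem, LinearMap.mem_ker]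
    exact Ideal.Quotient.eq_zero_iff_mem.2 (Ideal.mem_span_singleton_self _)
  let ψ : M' →ₗ[R] ExteriorAlgebra R M ⧸ J :=
    (Submodule.liftQ _ g hg) ∘ₗ (q.quotKerEquivOfSurjective hq).symm.toLinearMap
  have hψ : ∀ m, ψ (q m) = Ideal.Quotient.mkₐ R J (ι R m) := by
    intro m
    have : (q.quotKerEquivOfSurjective hq).symm (q m) = Submodule.Quotient.mk m := by
      rw [LinearEquiv.symm_apply_eq]
      rfl
    simp only [ψ, LinearMap.comp_apply, LinearEquiv.coe_coe, this, Submodule.liftQ_apply]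
    rfl
  have hsq : ∀ m', ψ m' * ψ m' = 0 := by
    intro m'
    obtain ⟨m, rfl⟩ := hq m'
    rw [hψ, ← map_mul, ι_sq_zero, map_zero]
  have hcomp : (lift R ⟨ψ, hsq⟩).comp (map q) = Ideal.Quotient.mkₐ R J := by
    ext m
    simp [hψ]
  have h1 : Ideal.Quotient.mkₐ R J x = 0 := by
    rw [← hcomp, AlgHom.comp_apply, hx, map_zero]
  have h2 : x ∈ J := Ideal.Quotient.eq_zero_iff_mem.1 h1
  rw [hJ, Ideal.mem_span_singleton'] at h2
  obtain ⟨y, hy⟩ := h2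
  exact ⟨y, hy.symm⟩

/-- Multiplication by v raises the degree by one, so only the degree-p component of y contributes.
-/
lemma exists_mem_eq_mul_ι {p : ℕ} {v : M} {x y : ExteriorAlgebra R M}
    (hx : x ∈ ⋀[R]^(p + 1) M) (hxy : x = y * ι R v) : ∃ z ∈ ⋀[R]^p M, x = z * ι R v := by
  have hv : ι R v ∈ ⋀[R]^1 M := by
    simpa only [pow_one] using LinearMap.mem_range_self (ι R) v
  refine ⟨DirectSum.decompose (fun n ↦ ⋀[R]^n M) y p, Subtype.property _, ?_⟩
  have h1 := DirectSum.coe_decompose_mul_of_right_mem (fun n ↦ ⋀[R]^n M) (p + 1) (a := y)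
    hv
  have h2 := DirectSum.decompose_of_mem_same (fun n ↦ ⋀[R]^n M) hx
  rw [← hxy, if_pos (by omega)] at h1
  exact h2.symm.trans h1

end ExteriorAlgebra

namespace exteriorPower

open ExteriorAlgebra

variable {R : Type*} [CommRing R] {M : Type*} [AddCommGroup M] [Module R M]
  {M' : Type*} [AddCommGroup M'] [Module R M']

lemma coe_map (p : ℕ) (f : M →ₗ[R] M') (x : ⋀[R]^p M) :
    (exteriorPower.map p f x : ExteriorAlgebra R M') = ExteriorAlgebra.map f x := by
  have h : (⋀[R]^p M').subtype ∘ₗ exteriorPower.map p f =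
      (ExteriorAlgebra.map f).toLinearMap ∘ₗ (⋀[R]^p M).subtype := by
    refine exteriorPower.linearMap_ext ?_
    ext m
    simp [ExteriorAlgebra.map_apply_ιMulti]
  exact LinearMap.congr_fun h x

/-- Right exterior multiplication by `v` in degree `p`. -/
def wedgeRight (p : ℕ) (v : M) : ⋀[R]^p M →ₗ[R] ⋀[R]^(p + 1) M :=
  ((LinearMap.mulRight R (ι R v)).comp (⋀[R]^p M).subtype).codRestrict _ fun x => by
    change _ ∈ LinearMap.range (ι R) ^ (p + 1)
    rw [pow_succ]
    exact Submodule.mul_mem_mul x.2 (LinearMap.mem_range_self _ v)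

@[simp]
lemma coe_wedgeRight (p : ℕ) (v : M) (x : ⋀[R]^p M) :
    (wedgeRight p v x : ExteriorAlgebra R M) = x * ι R v := rfl

/-- If `v` is unimodular up to an ideal `I` and `⋀^p (M / Rv)` has no `I`-torsion, then
`0 → ⋀^p (M / Rv) → ⋀^(p+1) M → ⋀^(p+1) (M / Rv) → 0` is exact. -/
lemma exists_injective_exact {I : Ideal R} {q : M →ₗ[R] M'} (hq : Function.Surjective q) {v : M}
    (hv : LinearMap.ker q = Submodule.span R {v})
    (hI : ∀ a ∈ I, ∃ φ : Module.Dual R M, φ v = a) {p : ℕ}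
    (htf : ∀ x : ⋀[R]^p M', (∀ a ∈ I, a • x = 0) → x = 0) :
    ∃ f : ⋀[R]^p M' →ₗ[R] ⋀[R]^(p + 1) M, Function.Injective f ∧
      Function.Exact f (exteriorPower.map (p + 1) q) := by
  have hqv : q v = 0 := by
    have : v ∈ LinearMap.ker q := hv ▸ Submodule.mem_span_singleton_self v
    exact this
  have hqp := exteriorPower.map_surjective (n := p) hq
  set qp := exteriorPower.map p q with hqpdef
  -- Multiples of v are killed by v. Conversely, if x ∧ v = 0, contracting with φ shows that φ(v)x
  -- is a multiple of v, so a = φ(v) kills the image of x in the I-torsion-free ⋀^p M'. Equal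
  -- kernels let wedging with v descend to an injection on ⋀^p M'.
  have hker : LinearMap.ker qp = LinearMap.ker (wedgeRight p v) := by
    ext x
    rw [LinearMap.mem_ker, LinearMap.mem_ker]
    constructor
    · intro h
      have h1 : ExteriorAlgebra.map q (x : ExteriorAlgebra R M) = 0 := by
        rw [← coe_map, ← hqpdef, h]; rfl
      obtain ⟨y, hy⟩ := exists_eq_mul_ι_of_map_eq_zero hq hv h1
      refine Subtype.ext ?_
      rw [coe_wedgeRight, hy, mul_ι_mul_ι_self]; rfl
    · intro h
      have h1 : (x : ExteriorAlgebra R M) * ι R v = 0 := congrArg Subtype.val h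
      refine htf _ fun a ha => ?_
      obtain ⟨φ, hφ⟩ := hI a ha
      have h2 := CliffordAlgebra.contractRight_mul_ι (Q := (0 : QuadraticForm R M)) φ v
        (x : ExteriorAlgebra R M)
      have h3 : a • (x : ExteriorAlgebra R M) =
          CliffordAlgebra.contractRight (Q := (0 : QuadraticForm R M))
            (x : ExteriorAlgebra R M) φ * ι R v := by
        rw [← hφ]
        refine sub_eq_zero.1 (h2.symm.trans ?_)
        have h4 : (x : ExteriorAlgebra R M) * CliffordAlgebra.ι (0 : QuadraticForm R M) v = 0 := h1
        rw [h4, LinearMap.map_zero, LinearMap.zero_apply]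
      refine Subtype.ext ?_
      rw [← map_smul, hqpdef, coe_map, Submodule.coe_smul, h3, map_mul, map_apply_ι, hqv, map_zero,
        mul_zero]
      rfl
  let f : ⋀[R]^p M' →ₗ[R] ⋀[R]^(p + 1) M :=
    (Submodule.liftQ _ (wedgeRight p v) hker.le) ∘ₗ
      (qp.quotKerEquivOfSurjective hqp).symm.toLinearMap
  have hf : ∀ x, f (qp x) = wedgeRight p v x := by
    intro x
    have : (qp.quotKerEquivOfSurjective hqp).symm (qp x) = Submodule.Quotient.mk x := by
      rw [LinearEquiv.symm_apply_eq]
      rfl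
    simp only [f, LinearMap.comp_apply, LinearEquiv.coe_coe, this, Submodule.liftQ_apply]
  refine ⟨f, ?_, fun z => ⟨fun hz => ?_, ?_⟩⟩
  · rw [← LinearMap.ker_eq_bot, LinearMap.ker_eq_bot']
    intro x' hx'
    obtain ⟨x, rfl⟩ := hqp x'
    rw [hf] at hx'
    have : x ∈ LinearMap.ker qp := hker ▸ hx'
    exact this
  · have h1 : ExteriorAlgebra.map q (z : ExteriorAlgebra R M) = 0 := by
      rw [← coe_map, hz]; rfl
    obtain ⟨y, hy⟩ := exists_eq_mul_ι_of_map_eq_zero hq hv h1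
    obtain ⟨w, hw, hzw⟩ := exists_mem_eq_mul_ι z.2 hy
    exact ⟨qp ⟨w, hw⟩, by rw [hf]; exact Subtype.ext hzw.symm⟩
  · rintro ⟨x', rfl⟩
    obtain ⟨x, rfl⟩ := hqp x'
    rw [hf]
    refine Subtype.ext ?_
    rw [coe_map, coe_wedgeRight, map_mul, map_apply_ι, hqv, map_zero, mul_zero]
    rfl

instance projective (p : ℕ) [Module.Finite R M] [Module.Projective R M] :
    Module.Projective R (⋀[R]^p M) := by
  obtain ⟨m, f, g, -, -, hfg⟩ := Module.Finite.exists_comp_eq_id_of_projective R M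
  exact Module.Projective.of_split (exteriorPower.map p g) (exteriorPower.map p f)
    (by rw [← exteriorPower.map_comp, hfg, exteriorPower.map_id])

end exteriorPower

universe u

/-- If `0 → R^s → P → M → 0` is exact with `P` projective, becomes split after multiplication by
elements of `I`, and `R` has depth greater than `k` with respect to `I`, then the exterior power
`⋀^p M` has depth greater than `k - p` for `p ≤ k`. -/
theorem ExtDepth.exteriorPower_of_presentation {R : Type u} [CommRing R] {I : Ideal R} {k : ℕ}
    (hR : ExtDepth I R (k + 1)) {P : Type u} [AddCommGroup P] [Module R P] [Module.Finite R P]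
    [Module.Projective R P] (p : ℕ) (hp : p ≤ k) (s : ℕ) (f : Fin s → P)
    (hσ : ∀ a ∈ I, ∃ σ : P →ₗ[R] (Fin s → R), ∀ j, σ (f j) = Pi.single j a)
    {M : Type u} [AddCommGroup M] [Module R M] {π : P →ₗ[R] M} (hπ : Function.Surjective π)
    (hker : LinearMap.ker π = Submodule.span R (Set.range f)) :
    ExtDepth I (⋀[R]^p M) (k + 1 - p) := by
  induction p generalizing s M with
  | zero => exact hR.of_equiv (exteriorPower.zeroEquiv R M).symm
  | succ p ihp =>
    induction s generalizing M with
    | zero =>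
      have h0 : LinearMap.ker π = ⊥ := by simp [hker]
      have e := LinearEquiv.ofBijective π ⟨LinearMap.ker_eq_bot.1 h0, hπ⟩
      have : Module.Finite R M := Module.Finite.equiv e
      have : Module.Projective R M := Module.Projective.of_equiv e
      exact (hR.of_projective).mono (by omega)
    | succ s ihs =>
      -- P/N omits the last relation, so the inner induction applies to it, and M is its quotient by
      -- a single vector.
      set N := Submodule.span R (Set.range (f ∘ Fin.castSucc)) with hN
      have hNle : N ≤ LinearMap.ker π := by
        rw [hker]
        exact Submodule.span_mono (Set.range_comp_subset_range _ _)
      let q : P ⧸ N →ₗ[R] M := N.liftQ π hNle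
      have hq : Function.Surjective q := fun m => by
        obtain ⟨x, rfl⟩ := hπ m
        exact ⟨N.mkQ x, by simp [q]⟩
      have hrange : Set.range f = Set.range (f ∘ Fin.castSucc) ∪ {f (Fin.last s)} := by
        ext x
        simp [Fin.exists_fin_succ', eq_comm, or_comm]
      have hqker : LinearMap.ker q = Submodule.span R {N.mkQ (f (Fin.last s))} := by
        rw [Submodule.ker_liftQ, hker, hrange, Submodule.span_union, Submodule.map_sup, ← hN,
          Submodule.mkQ_map_self, bot_sup_eq, Submodule.map_span, Set.image_singleton]
      have h1 : ExtDepth I (⋀[R]^(p + 1) (P ⧸ N)) (k + 1 - (p + 1)) := by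
        refine ihs (f ∘ Fin.castSucc) (fun a ha => ?_) N.mkQ_surjective (N.ker_mkQ)
        obtain ⟨σ, hσ⟩ := hσ a ha
        refine ⟨LinearMap.funLeft R R Fin.castSucc ∘ₗ σ, fun j => ?_⟩
        ext i
        simp [hσ, LinearMap.funLeft_apply, Pi.single_apply]
      have h2 : ExtDepth I (⋀[R]^p M) (k + 1 - p) := ihp (by omega) (s + 1) f hσ hπ hker
      obtain ⟨g, hg, hgq⟩ := exteriorPower.exists_injective_exact (I := I) hq hqker
        (fun a ha => by
          obtain ⟨σ, hσ⟩ := hσ a ha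
          -- The last coordinate of σ kills the earlier relations and takes the value a on the last
          -- one.
          refine ⟨N.liftQ (LinearMap.proj (Fin.last s) ∘ₗ σ) ?_, ?_⟩
          · rw [hN, Submodule.span_le]
            rintro _ ⟨j, rfl⟩
            simp [hσ, Fin.ext_iff, (Fin.is_lt j).ne']
          · simp [hσ])
        -- Here p + 1 ≤ k, so ⋀^p M has depth k + 1 - p ≥ 1 and no I-torsion.
        (ExtDepth.one_iff.1 (h2.mono (by omega)))
      have h3 : k + 1 - p = k + 1 - (p + 1) + 1 := by omega
      rw [h3] at h2
      exact ExtDepth.right_of_exact hg hgq (exteriorPower.map_surjective hq) h2 h1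

end

/-! ### Presentations of length one and their splitting ideal -/

noncomputable section

open CategoryTheory

universe u

section LiftIdeal

variable {R : Type*} [CommRing R] {P M : Type*} [AddCommGroup P] [Module R P] [AddCommGroup M]
  [Module R M]

/-- The ideal of all `a ∈ R` such that multiplication by `a` on `M` lifts along `π : P → M`. -/
def liftIdeal (π : P →ₗ[R] M) : Ideal R where
  carrier := {a | ∃ u : M →ₗ[R] P, ∀ m, π (u m) = a • m}
  add_mem' := by
    rintro a b ⟨u, hu⟩ ⟨v, hv⟩
    exact ⟨u + v, fun m => by simp [hu, hv, add_smul]⟩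
  zero_mem' := ⟨0, by simp⟩
  smul_mem' := by
    rintro c a ⟨u, hu⟩
    exact ⟨c • u, fun m => by simp [hu, mul_smul]⟩

/-- If u lifts a·id_M, then a·id_P - u∘π lands in ker π and is multiplication by a there; σ is this
map in the coordinates of the basis f. -/
lemma exists_retraction_of_mem_liftIdeal {π : P →ₗ[R] M} {s : ℕ} {f : Fin s → P}
    (hf : LinearIndependent R f) (hker : LinearMap.ker π = Submodule.span R (Set.range f))
    {a : R} (ha : a ∈ liftIdeal π) :
    ∃ σ : P →ₗ[R] (Fin s → R), ∀ j, σ (f j) = Pi.single j a := by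
  obtain ⟨u, hu⟩ := ha
  let τ : P →ₗ[R] Submodule.span R (Set.range f) :=
    (a • LinearMap.id - u ∘ₗ π).codRestrict _ fun x => by
      rw [← hker, LinearMap.mem_ker]
      simp [hu]
  refine ⟨(Finsupp.linearEquivFunOnFinite R R (Fin s)).toLinearMap ∘ₗ hf.repr ∘ₗ τ, fun j => ?_⟩
  have hfj : π (f j) = 0 := by
    rw [← LinearMap.mem_ker, hker]
    exact Submodule.subset_span ⟨j, rfl⟩
  have h1 : τ (f j) = a • ⟨f j, Submodule.subset_span ⟨j, rfl⟩⟩ := by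
    refine Subtype.ext ?_
    simp [τ, hfj]
  rw [LinearMap.comp_apply, LinearMap.comp_apply, h1, map_smul, map_smul,
    hf.repr_eq_single j _ rfl]
  ext i
  simp [Pi.single_apply, eq_comm]

/-- Over the local ring M is projective and π splits. Finite presentation lets one clear
denominators: s times the splitting comes from a map M → P, and a further factor t makes the lifting
identity hold over R. So the primes containing `liftIdeal π` are non-free points. -/
lemma exists_mem_liftIdeal_notMem [Module.FinitePresentation R M] {π : P →ₗ[R] M}
    (hπ : Function.Surjective π) {p : PrimeSpectrum R} (hp : p ∈ Module.freeLocus R M) :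
    ∃ a ∈ liftIdeal π, a ∉ p.asIdeal := by
  set S := p.asIdeal.primeCompl
  have hfree : Module.Free (Localization S) (LocalizedModule S M) := hp
  have hsurj : Function.Surjective (LocalizedModule.map S π) :=
    LocalizedModule.map_surjective S π hπ
  obtain ⟨τ, hτ⟩ := Module.projective_lifting_property (LocalizedModule.map S π) LinearMap.id hsurj
  obtain ⟨h, s, hs⟩ := Module.FinitePresentation.exists_lift_of_isLocalizedModule S
    (LocalizedModule.mkLinearMap S P) ((τ.restrictScalars R) ∘ₗ LocalizedModule.mkLinearMap S M)
  have h1 : LocalizedModule.mkLinearMap S M ∘ₗ (π ∘ₗ h) =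
      LocalizedModule.mkLinearMap S M ∘ₗ ((s : R) • LinearMap.id) := by
    ext m
    have h2 := LinearMap.congr_fun hs m
    have h3 : LocalizedModule.mkLinearMap S M (π (h m)) =
        LocalizedModule.map S π (LocalizedModule.mkLinearMap S P (h m)) := by
      simp [LocalizedModule.map_mk]
    have h4 : LocalizedModule.map S π (τ (LocalizedModule.mkLinearMap S M m)) =
        LocalizedModule.mkLinearMap S M m := LinearMap.congr_fun hτ _
    have h5 := ((LocalizedModule.map S π).restrictScalars R).map_smul (s : R)
      (τ (LocalizedModule.mkLinearMap S M m))
    rw [LinearMap.restrictScalars_apply, LinearMap.restrictScalars_apply, h4] at h5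
    rw [LinearMap.comp_apply] at h2
    rw [LinearMap.comp_apply, LinearMap.comp_apply, h3, h2]
    refine h5.trans ?_
    simp
  obtain ⟨t, ht⟩ := Module.Finite.exists_smul_of_comp_eq_of_isLocalizedModule S
    (LocalizedModule.mkLinearMap S M) _ _ h1
  refine ⟨t * s, ⟨(t : R) • h, fun m => ?_⟩, fun hmem => ?_⟩
  · have := LinearMap.congr_fun ht m
    simpa [mul_smul, Submonoid.smul_def] using this
  · exact (p.2.mem_or_mem hmem).elim t.2 s.2

end LiftIdeal

/-- A finite module of projective dimension at most one over a noetherian ring is the quotient of a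
finite projective module by a finite free submodule. -/
lemma exists_free_ker_of_hasProjectiveDimensionLE_one {R : Type u} [CommRing R]
    [IsNoetherianRing R] {M : Type u} [AddCommGroup M] [Module R M] [Module.Finite R M]
    (h : HasProjectiveDimensionLE (ModuleCat.of R M) 1) :
    ∃ (P : Type u) (_ : AddCommGroup P) (_ : Module R P) (_ : Module.Finite R P)
      (_ : Module.Projective R P) (s : ℕ) (f : Fin s → P) (π : P →ₗ[R] M),
      LinearIndependent R f ∧ Function.Surjective π ∧
        LinearMap.ker π = Submodule.span R (Set.range f) := by
  obtain ⟨n, π₀, hπ₀⟩ := Module.Finite.exists_fin' R M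
  set K := LinearMap.ker π₀ with hK
  have hproj : Module.Projective R K := by
    have hS := ExtDepth.shortExact K.subtype_injective (LinearMap.exact_subtype_ker_map π₀) hπ₀
    have hP : Projective (ModuleCat.of R (Fin n → R)) :=
      ModuleCat.projective_of_categoryTheory_projective _
    have h1 := (hS.hasProjectiveDimensionLT_X₃_iff 0 hP).1 h
    have h2 : Projective (ModuleCat.of R K) := projective_iff_hasProjectiveDimensionLT_one.2 h1
    exact (IsProjective.iff_projective K).2 h2
  obtain ⟨s, f, g, -, -, hfg⟩ := Module.Finite.exists_comp_eq_id_of_projective R K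
  have hfg' : ∀ x, f (g x) = x := LinearMap.congr_fun hfg
  -- The kernel K is only projective, a summand of R^s with complement ker f. Adding ker f to the
  -- cover R^n, mapped to zero in M, turns the kernel into K ⊕ ker f ≅ R^s.
  let j : (Fin s → R) →ₗ[R] (Fin n → R) × LinearMap.ker f :=
    (K.subtype ∘ₗ f).prod ((LinearMap.id - g ∘ₗ f).codRestrict _ fun x => by simp [hfg'])
  have hj : Function.Injective j := by
    rw [← LinearMap.ker_eq_bot, LinearMap.ker_eq_bot']
    intro x hx
    have h1 : f x = 0 := Subtype.ext (congrArg Prod.fst hx)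
    have h2 : x - g (f x) = 0 := congrArg (fun y => (y.2 : Fin s → R)) hx
    simpa [h1] using h2
  have : Module.Projective R (LinearMap.ker f) := by
    refine Module.Projective.of_split (LinearMap.ker f).subtype
      ((LinearMap.id - g ∘ₗ f).codRestrict _ fun x => by simp [hfg']) ?_
    ext x
    have : f x = 0 := x.2
    simp [this]
  refine ⟨(Fin n → R) × LinearMap.ker f, inferInstance, inferInstance, inferInstance,
    inferInstance, s, fun i => j (Pi.single i 1), π₀ ∘ₗ LinearMap.fst R _ _, ?_, ?_, ?_⟩
  · have := (Pi.basisFun R (Fin s)).linearIndependent.map' j (LinearMap.ker_eq_bot.2 hj)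
    simpa [Function.comp_def] using this
  · exact hπ₀.comp LinearMap.fst_surjective
  · have h1 : Set.range (fun i => j (Pi.single i 1)) = j '' Set.range (Pi.basisFun R (Fin s)) := by
      rw [← Set.range_comp]
      exact congrArg Set.range (funext fun i => by rw [Function.comp_apply, Pi.basisFun_apply])
    rw [h1, ← Submodule.map_span, (Pi.basisFun R (Fin s)).span_eq, Submodule.map_top]
    ext ⟨x, y⟩
    constructor
    · intro hx
      have hx' : x ∈ K := hx
      refine ⟨g ⟨x, hx'⟩ + y, Prod.ext ?_ (Subtype.ext ?_)⟩
      · have : f y = 0 := y.2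
        simp [j, hfg', this]
      · have : f y = 0 := y.2
        simp [j, hfg', this]
    · rintro ⟨z, hz⟩
      have : ((f z : K) : Fin n → R) = x := congrArg Prod.fst hz
      rw [LinearMap.mem_ker, LinearMap.comp_apply, LinearMap.fst_apply, ← this]
      exact (f z).2

end

/-! ### Integral forms inside forms over the fraction field -/

noncomputable section

open ExteriorAlgebra

/-- An element of the fraction field all of whose multiples by elements of a set without common
prime factor are integral is integral. -/
lemma mem_range_algebraMap_of_forall_prime {R K : Type*} [CommRing R] [IsDomain R]
    [UniqueFactorizationMonoid R] [Field K] [Algebra R K] [IsFractionRing R K] {T : Set R}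
    (hT : ∀ q : R, Prime q → ∃ r ∈ T, ¬ q ∣ r) {c : K}
    (hc : ∀ r ∈ T, r • c ∈ Set.range (algebraMap R K)) : c ∈ Set.range (algebraMap R K) := by
  obtain ⟨a, b, hab, rfl⟩ := IsFractionRing.exists_reduced_fraction R c
  have hb0 : (b : R) ≠ 0 := nonZeroDivisors.coe_ne_zero b
  have hbK : algebraMap R K b ≠ 0 := by simp [hb0]
  have hmk : IsLocalization.mk' K a b = algebraMap R K a / algebraMap R K b :=
    IsFractionRing.mk'_eq_div b
  by_cases hb : IsUnit (b : R)
  · obtain ⟨u, hu⟩ := hb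
    refine ⟨a * ↑u⁻¹, ?_⟩
    rw [hmk, eq_div_iff hbK, ← hu, ← map_mul, mul_assoc, Units.inv_mul, mul_one]
  -- A prime factor of the denominator in lowest terms would have to divide every element of T.
  · obtain ⟨q, hq, hqb⟩ := WfDvdMonoid.exists_irreducible_factor hb hb0
    obtain ⟨r, hr, hqr⟩ := hT q hq.prime
    obtain ⟨s, hs⟩ := hc r hr
    rw [hmk, Algebra.smul_def, mul_div_assoc', eq_div_iff hbK, ← map_mul, ← map_mul] at hs
    have h1 := IsFractionRing.injective R K hs
    have h2 : q ∣ r * a := h1 ▸ hqb.mul_left s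
    exact absurd (hab ((hq.prime.dvd_or_dvd h2).resolve_left hqr) hqb) hq.not_isUnit

section Graded

variable {R K : Type*} [CommRing R] [Field K] [Algebra R K] {N V : Type*} [AddCommGroup N]
  [Module R N] [AddCommGroup V] [Module K V] [Module R V] [IsScalarTower R K V]

lemma map_mem_exteriorPower {φ : ExteriorAlgebra R N →ₐ[R] ExteriorAlgebra K V}
    (hφ : ∀ m, φ (ι R m) ∈ LinearMap.range (ι K : V →ₗ[K] ExteriorAlgebra K V)) {p : ℕ}
    {x : ExteriorAlgebra R N} (hx : x ∈ ⋀[R]^p N) : φ x ∈ ⋀[K]^p V := by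
  change x ∈ LinearMap.range (ι R) ^ p at hx
  change φ x ∈ LinearMap.range (ι K) ^ p
  induction hx using Submodule.pow_induction_on_left' with
  | algebraMap r =>
    rw [AlgHom.commutes, pow_zero, IsScalarTower.algebraMap_apply R K]
    exact Submodule.algebraMap_mem _
  | add x y i hx hy ihx ihy => rw [map_add]; exact add_mem ihx ihy
  | mem_mul m hm i x hx ih =>
    obtain ⟨m, rfl⟩ := hm
    rw [map_mul, pow_succ']
    exact Submodule.mul_mem_mul (hφ m) ih

/-- An algebra homomorphism of exterior algebras that preserves degree one is graded. -/
lemma exists_mem_exteriorPower_map_eq {φ : ExteriorAlgebra R N →ₐ[R] ExteriorAlgebra K V}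
    (hφ : ∀ m, φ (ι R m) ∈ LinearMap.range (ι K : V →ₗ[K] ExteriorAlgebra K V)) {p : ℕ}
    {x : ExteriorAlgebra R N} (hx : φ x ∈ ⋀[K]^p V) : ∃ x' ∈ ⋀[R]^p N, φ x' = φ x := by
  classical
  refine ⟨DirectSum.decompose (fun i ↦ ⋀[R]^i N) x p, Subtype.property _, ?_⟩
  have h1 : ∀ x : ExteriorAlgebra R N,
      φ (DirectSum.decompose (fun i ↦ ⋀[R]^i N) x p) =
        DirectSum.decompose (fun i ↦ ⋀[K]^i V) (φ x) p := by
    intro x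
    induction x using DirectSum.Decomposition.inductionOn fun i ↦ ⋀[R]^i N with
    | zero => simp
    | @homogeneous i m =>
      obtain rfl | hi := eq_or_ne i p
      · exact (congrArg φ (DirectSum.decompose_of_mem_same (fun j ↦ ⋀[R]^j N) m.2)).trans
          (DirectSum.decompose_of_mem_same (fun j ↦ ⋀[K]^j V)
            (map_mem_exteriorPower hφ m.2)).symm
      · exact (congrArg φ (DirectSum.decompose_of_mem_ne (fun j ↦ ⋀[R]^j N) m.2 hi)).trans
          ((map_zero φ).trans (DirectSum.decompose_of_mem_ne (fun j ↦ ⋀[K]^j V)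
            (map_mem_exteriorPower hφ m.2) hi).symm)
    | add a b ha hb =>
      rw [DirectSum.decompose_add, map_add, DirectSum.decompose_add, DirectSum.add_apply,
        DirectSum.add_apply, Submodule.coe_add, Submodule.coe_add, map_add, ha, hb]
  rw [h1]
  exact DirectSum.decompose_of_mem_same (fun i ↦ ⋀[K]^i V) hx

lemma map_exteriorPower_eq_pow (φ : ExteriorAlgebra R N →ₐ[R] ExteriorAlgebra K V) (p : ℕ) :
    (⋀[R]^p N).map φ.toLinearMap = ((LinearMap.range (ι R)).map φ.toLinearMap) ^ p :=
  Submodule.map_pow _ φ p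

end Graded

lemma map_smul_id_of_mem_exteriorPower {R M : Type*} [CommRing R] [AddCommGroup M] [Module R M]
    (a : R) {p : ℕ} {x : ExteriorAlgebra R M} (hx : x ∈ ⋀[R]^p M) :
    ExteriorAlgebra.map (a • (LinearMap.id : M →ₗ[R] M)) x = a ^ p • x := by
  change x ∈ LinearMap.range (ι R) ^ p at hx
  induction hx using Submodule.pow_induction_on_left' with
  | algebraMap r => simp
  | add x y i hx hy ihx ihy => rw [map_add, ihx, ihy, smul_add]
  | mem_mul m hm i x hx ih =>
    obtain ⟨m, rfl⟩ := hm
    rw [map_mul, map_apply_ι, ih, LinearMap.smul_apply, LinearMap.id_apply, map_smul,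
      smul_mul_smul_comm, pow_succ']

section Frac

variable (R K : Type*) [CommRing R] [Field K] [Algebra R K] (n : ℕ)

/-- The extension of scalars `⋀_R R^n → ⋀_K K^n`. -/
def extendForms : ExteriorAlgebra R (Fin n → R) →ₐ[R] ExteriorAlgebra K (Fin n → K) :=
  ExteriorAlgebra.lift R ⟨((ι K).restrictScalars R) ∘ₗ (Algebra.linearMap R K).compLeft (Fin n),
    fun _ => ι_sq_zero _⟩

variable {R K n}

@[simp]
lemma extendForms_ι (v : Fin n → R) :
    extendForms R K n (ι R v) = ι K (fun i => algebraMap R K (v i)) := by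
  exact (lift_ι_apply R _ _ v).trans rfl

lemma extendForms_ι_mem (v : Fin n → R) : extendForms R K n (ι R v) ∈
    LinearMap.range (ι K : (Fin n → K) →ₗ[K] ExteriorAlgebra K (Fin n → K)) :=
  ⟨_, (extendForms_ι v).symm⟩

lemma extendForms_ι_single (i : Fin n) :
    extendForms R K n (ι R (Pi.single i 1)) = ι K (Pi.single i 1) := by
  rw [extendForms_ι]
  congr 1
  ext j
  by_cases h : j = i
  · subst h; simp
  · simp [h]

lemma extendForms_basis (S : Finset (Fin n)) :
    extendForms R K n ((Pi.basisFun R (Fin n)).ExteriorAlgebra S) =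
      (Pi.basisFun K (Fin n)).ExteriorAlgebra S := by
  rw [basis_apply, basis_apply]
  simp only [ExteriorAlgebra.ιMulti_family]
  rw [ιMulti_apply, ιMulti_apply, map_list_prod, List.map_ofFn]
  congr 2
  ext i
  simp only [Function.comp_apply, Pi.basisFun_apply, extendForms_ι_single]

lemma repr_extendForms (x : ExteriorAlgebra R (Fin n → R)) (S : Finset (Fin n)) :
    (Pi.basisFun K (Fin n)).ExteriorAlgebra.repr (extendForms R K n x) S =
      algebraMap R K ((Pi.basisFun R (Fin n)).ExteriorAlgebra.repr x S) := by
  classical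
  have h1 : extendForms R K n x = ∑ T, algebraMap R K
      ((Pi.basisFun R (Fin n)).ExteriorAlgebra.repr x T) •
        (Pi.basisFun K (Fin n)).ExteriorAlgebra T := by
    conv_lhs => rw [← (Pi.basisFun R (Fin n)).ExteriorAlgebra.sum_repr x]
    rw [map_sum]
    refine Finset.sum_congr rfl fun T _ => ?_
    rw [map_smul, extendForms_basis, algebraMap_smul]
  rw [h1, Module.Basis.repr_sum_self]

lemma extendForms_injective [IsDomain R] [IsFractionRing R K] :
    Function.Injective (extendForms R K n) := by
  intro x y hxy
  refine (Pi.basisFun R (Fin n)).ExteriorAlgebra.repr.injective (Finsupp.ext fun S => ?_)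
  refine IsFractionRing.injective R K ?_
  rw [← repr_extendForms, hxy, repr_extendForms]

lemma mem_range_extendForms_iff (y : ExteriorAlgebra K (Fin n → K)) :
    y ∈ (extendForms R K n).range ↔
      ∀ S, (Pi.basisFun K (Fin n)).ExteriorAlgebra.repr y S ∈ Set.range (algebraMap R K) := by
  constructor
  · rintro ⟨x, rfl⟩ S
    exact ⟨_, (repr_extendForms x S).symm⟩
  · intro h
    choose c hc using h
    refine ⟨∑ S, c S • (Pi.basisFun R (Fin n)).ExteriorAlgebra S, ?_⟩
    conv_rhs => rw [← (Pi.basisFun K (Fin n)).ExteriorAlgebra.sum_repr y]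
    simp only [AlgHom.toRingHom_eq_coe, RingHom.coe_coe, map_sum, map_smul, extendForms_basis]
    refine Finset.sum_congr rfl fun S _ => ?_
    rw [← hc, algebraMap_smul]

/-- The scalar criterion applies to each coefficient in the standard basis. It replaces a
reflexivity argument: regularity is checked in codimension one. -/
lemma mem_range_extendForms_of_forall_prime [IsDomain R] [UniqueFactorizationMonoid R]
    [IsFractionRing R K] {T : Set R} (hT : ∀ q : R, Prime q → ∃ r ∈ T, ¬ q ∣ r)
    {y : ExteriorAlgebra K (Fin n → K)} (hy : ∀ r ∈ T, r • y ∈ (extendForms R K n).range) :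
    y ∈ (extendForms R K n).range := by
  rw [mem_range_extendForms_iff]
  intro S
  refine mem_range_algebraMap_of_forall_prime hT fun r hr => ?_
  have := (mem_range_extendForms_iff _).1 (hy r hr) S
  rwa [← algebraMap_smul K, map_smul, Finsupp.smul_apply, algebraMap_smul] at this

lemma involute_extendForms (x : ExteriorAlgebra R (Fin n → R)) :
    CliffordAlgebra.involute (extendForms R K n x) =
      extendForms R K n (CliffordAlgebra.involute x) := by
  have inv_ι : ∀ v : Fin n → K, CliffordAlgebra.involute (ι K v) = -ι K v :=
    fun v => CliffordAlgebra.involute_ι v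
  have inv_ι' : ∀ v : Fin n → R, CliffordAlgebra.involute (ι R v) = -ι R v :=
    fun v => CliffordAlgebra.involute_ι v
  induction x using ExteriorAlgebra.induction with
  | algebraMap r =>
    rw [AlgHom.commutes, AlgHom.commutes, AlgHom.commutes, IsScalarTower.algebraMap_apply R K,
      AlgHom.commutes]
  | ι v => rw [extendForms_ι, inv_ι, inv_ι', map_neg, extendForms_ι]
  | mul a b ha hb => rw [map_mul, map_mul, map_mul, map_mul, ha, hb]
  | add a b ha hb => rw [map_add, map_add, map_add, map_add, ha, hb]

lemma contractLeft_extendForms {d' : Module.Dual R (Fin n → R)} {d : Module.Dual K (Fin n → K)}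
    (hd : ∀ v, d (fun i => algebraMap R K (v i)) = algebraMap R K (d' v))
    (x : ExteriorAlgebra R (Fin n → R)) :
    CliffordAlgebra.contractLeft (Q := (0 : QuadraticForm K (Fin n → K))) d
        (extendForms R K n x) =
      extendForms R K n
        (CliffordAlgebra.contractLeft (Q := (0 : QuadraticForm R (Fin n → R))) d' x) := by
  induction x using CliffordAlgebra.left_induction with
  | algebraMap r =>
    rw [CliffordAlgebra.contractLeft_algebraMap]
    have : extendForms R K n (algebraMap R (ExteriorAlgebra R (Fin n → R)) r) =
        algebraMap K _ (algebraMap R K r) := by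
      rw [AlgHom.commutes, IsScalarTower.algebraMap_apply R K]
    erw [this, CliffordAlgebra.contractLeft_algebraMap, map_zero]
  | add x y hx hy => rw [map_add, map_add, hx, hy, map_add, map_add]
  | ι_mul x v hx =>
    rw [CliffordAlgebra.contractLeft_ι_mul]
    have h1 : extendForms R K n (CliffordAlgebra.ι 0 v * x) =
        CliffordAlgebra.ι (0 : QuadraticForm K (Fin n → K)) (fun i => algebraMap R K (v i)) *
          extendForms R K n x := by
      rw [map_mul]
      congr 1
      exact extendForms_ι v
    have h2 : ∀ z, extendForms R K n (CliffordAlgebra.ι 0 v * z) =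
        CliffordAlgebra.ι (0 : QuadraticForm K (Fin n → K)) (fun i => algebraMap R K (v i)) *
          extendForms R K n z := by
      intro z
      rw [map_mul]
      congr 1
      exact extendForms_ι v
    rw [h1, CliffordAlgebra.contractLeft_ι_mul, map_sub, h2, hx, hd, map_smul, algebraMap_smul]

end Frac

end

/-! ### Depth of the exterior powers of a module over the coordinate ring -/

noncomputable section

open CategoryTheory

/-- A finite module `M` of projective dimension at most one over the coordinate ring whose non-free
locus has codimension greater than `k`: the exterior powers of `M` have depth with respect to an
ideal whose elements, as multiplications on `M`, factor through finite free modules. -/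
theorem exists_ideal_extDepth_exteriorPower {ℓ k : ℕ} {M : Type} [AddCommGroup M]
    [Module (CoordRing ℓ) M] [Module.Finite (CoordRing ℓ) M]
    (hpd : HasProjectiveDimensionLE (ModuleCat.of (CoordRing ℓ) M) 1)
    (hcodim : (k : ℕ∞) < specCodim (Module.freeLocus (CoordRing ℓ) M)ᶜ) :
    ∃ I : Ideal (CoordRing ℓ), I ≠ ⊥ ∧
      (∀ a ∈ I, ∃ (n : ℕ) (g : M →ₗ[CoordRing ℓ] (Fin n → CoordRing ℓ))
        (h : (Fin n → CoordRing ℓ) →ₗ[CoordRing ℓ] M), ∀ m, h (g m) = a • m) ∧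
      ∀ p ≤ k, ExtDepth I (⋀[CoordRing ℓ]^p M) (k + 1 - p) := by
  obtain ⟨P, _, _, _, _, s, f, π, hf, hπ, hker⟩ :=
    exists_free_ker_of_hasProjectiveDimensionLE_one hpd
  have : Module.FinitePresentation (CoordRing ℓ) M := Module.finitePresentation_of_finite _ _
  have hheight : ∀ Q : Ideal (CoordRing ℓ), Q.IsPrime → liftIdeal π ≤ Q →
      ((k + 1 : ℕ) : ℕ∞) ≤ Q.height := by
    intro Q hQ hle
    have h1 : (⟨Q, hQ⟩ : PrimeSpectrum (CoordRing ℓ)) ∈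
        (Module.freeLocus (CoordRing ℓ) M)ᶜ := by
      intro hmem
      obtain ⟨a, ha, haQ⟩ := exists_mem_liftIdeal_notMem hπ hmem
      exact haQ (hle ha)
    have h2 : (k : ℕ∞) < Q.height :=
      hcodim.trans_le (iInf₂_le (⟨Q, hQ⟩ : PrimeSpectrum (CoordRing ℓ)) h1)
    exact_mod_cast Order.add_one_le_of_lt h2
  refine ⟨liftIdeal π, ?_, ?_, ?_⟩
  · intro h0
    have := hheight ⊥ Ideal.isPrime_bot h0.le
    rw [Ideal.height_bot] at this
    exact absurd (Nat.cast_le.1 this) (by omega)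
  · rintro a ⟨u, hu⟩
    -- P is a summand of some R^n, so a factorization through P becomes one through R^n.
    obtain ⟨n, v, w, -, -, hvw⟩ := Module.Finite.exists_comp_eq_id_of_projective (CoordRing ℓ) P
    refine ⟨n, w ∘ₗ u, π ∘ₗ v, fun m => ?_⟩
    have := LinearMap.congr_fun hvw (u m)
    rw [LinearMap.comp_apply, LinearMap.id_apply] at this
    simp [this, hu]
  · obtain ⟨rs, hlen, hmem, hreg⟩ :=
      MvPolynomial.exists_isWeaklyRegular_of_le_height ℓ (k + 1) _ hheight
    have hR := ExtDepth.of_isWeaklyRegular rs hmem hreg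
    rw [hlen] at hR
    exact fun p hp => hR.exteriorPower_of_presentation p hp s f
      (fun a ha => exists_retraction_of_mem_liftIdeal hf hker ha) hπ hker

end

/-! ### Logarithmic forms and their poles along a single hyperplane -/

noncomputable section

open ExteriorAlgebra

section PolynomialForms

variable {ℓ : ℕ}

/-- The inclusion of the algebra of polynomial forms into the algebra of rational forms. -/
abbrev polyToRat (ℓ : ℕ) : ExteriorAlgebra (CoordRing ℓ) (Fin ℓ → CoordRing ℓ) →ₐ[CoordRing ℓ]
    RatForms ℓ :=
  extendForms (CoordRing ℓ) (RatFun ℓ) ℓ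

lemma differential_X (i : Fin ℓ) :
    differential (MvPolynomial.X i : CoordRing ℓ) = Pi.single i 1 := by
  ext j
  rw [differential, MvPolynomial.pderiv_X]
  by_cases h : j = i
  · subst h; simp
  · rw [Pi.single_eq_of_ne h, Pi.single_eq_of_ne (Ne.symm h), map_zero]

lemma differential_linearPoly (α : Module.Dual ℂ (Fin ℓ → ℂ)) :
    differential (linearPoly α) = fun i => algebraMap (CoordRing ℓ) (RatFun ℓ)
      (MvPolynomial.C (α (Pi.single i 1))) := by
  classical
  ext j
  rw [differential, linearPoly, map_sum]
  congr 1
  simp only [MvPolynomial.pderiv_C_mul, MvPolynomial.pderiv_X]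
  rw [Finset.sum_eq_single j]
  · simp
  · intro i _ hij
    rw [Pi.single_eq_of_ne hij, mul_zero]
  · simp

lemma polyOneForms_eq_map :
    polyOneForms ℓ = (LinearMap.range (ι (CoordRing ℓ) (M := Fin ℓ → CoordRing ℓ))).map
      (polyToRat ℓ).toLinearMap := by
  rw [← Submodule.map_top, ← (Pi.basisFun (CoordRing ℓ) (Fin ℓ)).span_eq, Submodule.map_span,
    Submodule.map_span, polyOneForms, ← Set.range_comp, ← Set.range_comp]
  congr 2
  ext1 i
  simp only [Function.comp_apply, Pi.basisFun_apply, AlgHom.toLinearMap_apply,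
    extendForms_ι_single, differential_X]

lemma polyForms_eq_map (p : ℕ) :
    polyForms ℓ p = (⋀[CoordRing ℓ]^p (Fin ℓ → CoordRing ℓ)).map (polyToRat ℓ).toLinearMap := by
  rw [polyForms, polyOneForms_eq_map, map_exteriorPower_eq_pow]

lemma mem_polyForms_iff {p : ℕ} {x : RatForms ℓ} :
    x ∈ polyForms ℓ p ↔ x ∈ (polyToRat ℓ).range ∧ x ∈ ⋀[RatFun ℓ]^p (RatOneForms ℓ) := by
  rw [polyForms_eq_map]
  constructor
  · rintro ⟨y, hy, rfl⟩
    exact ⟨⟨y, rfl⟩, map_mem_exteriorPower extendForms_ι_mem hy⟩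
  · rintro ⟨⟨y, rfl⟩, h⟩
    obtain ⟨y', hy', h'⟩ := exists_mem_exteriorPower_map_eq extendForms_ι_mem h
    exact ⟨y', hy', h'⟩

lemma smul_mem_exteriorPower_iff {r : CoordRing ℓ} (hr : r ≠ 0) {p : ℕ} {x : RatForms ℓ} :
    r • x ∈ ⋀[RatFun ℓ]^p (RatOneForms ℓ) ↔ x ∈ ⋀[RatFun ℓ]^p (RatOneForms ℓ) := by
  have hr' : algebraMap (CoordRing ℓ) (RatFun ℓ) r ≠ 0 := by simpa using hr
  rw [← algebraMap_smul (RatFun ℓ), Submodule.smul_mem_iff _ hr']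

lemma smul_right_cancel_ratForms {r : CoordRing ℓ} (hr : r ≠ 0) {x y : RatForms ℓ}
    (h : r • x = r • y) : x = y := by
  have hr' : algebraMap (CoordRing ℓ) (RatFun ℓ) r ≠ 0 := by simpa using hr
  rw [← algebraMap_smul (RatFun ℓ) r x, ← algebraMap_smul (RatFun ℓ) r y] at h
  exact smul_right_injective _ hr' h

lemma ι_mul_mem_exteriorPower {K V : Type*} [Field K] [AddCommGroup V] [Module K V] {p : ℕ}
    (v : V) {x : ExteriorAlgebra K V} (hx : x ∈ ⋀[K]^p V) : ι K v * x ∈ ⋀[K]^(p + 1) V := by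
  change _ ∈ LinearMap.range (ι K) ^ (p + 1)
  rw [pow_succ']
  exact Submodule.mul_mem_mul ⟨v, rfl⟩ hx

end PolynomialForms

namespace CentralArrangement

variable {ℓ : ℕ} (A : CentralArrangement ℓ)

lemma smul_dlog {α : Module.Dual ℂ (Fin ℓ → ℂ)} (hα : α ≠ 0) :
    linearPoly α • dlog α = ι (RatFun ℓ) (differential (linearPoly α)) := by
  have h : algebraMap (CoordRing ℓ) (RatFun ℓ) (linearPoly α) ≠ 0 := by
    simpa using linearPoly_ne_zero hα
  rw [dlog, ← algebraMap_smul (RatFun ℓ), ← map_smul, smul_smul, mul_inv_cancel₀ h, one_smul]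

lemma ι_differential_mem (α : Module.Dual ℂ (Fin ℓ → ℂ)) :
    ι (RatFun ℓ) (differential (linearPoly α)) ∈ (polyToRat ℓ).range :=
  ⟨ι _ fun i => MvPolynomial.C (α (Pi.single i 1)), by
    rw [differential_linearPoly]; exact extendForms_ι _⟩

lemma smul_dlog_mem {α : Module.Dual ℂ (Fin ℓ → ℂ)} (hα : α ≠ 0) :
    linearPoly α • dlog α ∈ (polyToRat ℓ).range := by
  rw [smul_dlog hα]
  exact ι_differential_mem α

lemma dlog_mul_self (α : Module.Dual ℂ (Fin ℓ → ℂ)) : dlog α * dlog α = 0 := ι_sq_zero _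

open scoped Classical in
/-- The product of the defining equations of all hyperplanes other than `ker α`. -/
def cofactor (α : Module.Dual ℂ (Fin ℓ → ℂ)) : CoordRing ℓ :=
  ∏ β ∈ A.forms.erase α, linearPoly β

variable {A}

lemma linearPoly_mul_cofactor {α : Module.Dual ℂ (Fin ℓ → ℂ)} (hα : α ∈ A.forms) :
    linearPoly α * A.cofactor α = A.definingPoly := by
  classical
  rw [cofactor, definingPoly, Finset.mul_prod_erase _ _ hα]

lemma linearPoly_dvd_cofactor {α β : Module.Dual ℂ (Fin ℓ → ℂ)} (hβ : β ∈ A.forms)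
    (h : β ≠ α) : linearPoly β ∣ A.cofactor α := by
  classical
  exact Finset.dvd_prod_of_mem _ (Finset.mem_erase.2 ⟨h, hβ⟩)

/-- Since f ≠ 0, the degree of a form can be read off before or after multiplication by f; this
separates homogeneity from the pole conditions. -/
lemma mem_logForms_iff {p : ℕ} {x : RatForms ℓ} :
    x ∈ A.logForms p ↔ x ∈ ⋀[RatFun ℓ]^p (RatOneForms ℓ) ∧
      A.definingPoly • x ∈ (polyToRat ℓ).range ∧
      ∀ α ∈ A.forms, A.definingPoly • (dlog α * x) ∈ (polyToRat ℓ).range := by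
  rw [logForms, Submodule.mem_inf, Submodule.mem_iInf]
  simp only [Submodule.mem_iInf, simplePoleForms, Submodule.mem_comap, LinearMap.lsmul_apply,
    LinearMap.mulLeft_apply, mem_polyForms_iff, smul_mem_exteriorPower_iff A.definingPoly_ne_zero]
  constructor
  · rintro ⟨⟨h1, h2⟩, h3⟩
    exact ⟨h2, h1, fun α hα => (h3 α hα).1⟩
  · rintro ⟨h1, h2, h3⟩
    exact ⟨⟨h2, h1⟩, fun α hα => ⟨h3 α hα, ι_mul_mem_exteriorPower _ h1⟩⟩

lemma definingPoly_smul_dlog_mem {α : Module.Dual ℂ (Fin ℓ → ℂ)} (hα : α ∈ A.forms) :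
    A.definingPoly • dlog α ∈ (polyToRat ℓ).range := by
  rw [← linearPoly_mul_cofactor hα, mul_comm, mul_smul]
  exact Subalgebra.smul_mem _ (smul_dlog_mem (A.form_ne_zero α hα)) _

lemma polyForms_le_logForms (p : ℕ) : polyForms ℓ p ≤ A.logForms p := by
  intro x hx
  rw [mem_polyForms_iff] at hx
  refine mem_logForms_iff.2 ⟨hx.2, Subalgebra.smul_mem _ hx.1 _, fun α hα => ?_⟩
  rw [← smul_mul_assoc]
  exact mul_mem (definingPoly_smul_dlog_mem hα) hx.1

lemma ι_single_mem_logForms (i : Fin ℓ) : ι (RatFun ℓ) (Pi.single i 1) ∈ A.logForms 1 := by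
  apply polyForms_le_logForms
  rw [polyForms, pow_one, ← differential_X]
  exact Submodule.subset_span ⟨i, rfl⟩

lemma ι_mem_exteriorPower_one {K V : Type*} [Field K] [AddCommGroup V] [Module K V] (v : V) :
    ι K v ∈ ⋀[K]^1 V := by
  change _ ∈ LinearMap.range (ι K) ^ 1
  rw [pow_one]
  exact ⟨v, rfl⟩

lemma dlog_mem_logForms {α : Module.Dual ℂ (Fin ℓ → ℂ)} (hα : α ∈ A.forms) :
    dlog α ∈ A.logForms 1 := by
  refine mem_logForms_iff.2 ⟨ι_mem_exteriorPower_one _, definingPoly_smul_dlog_mem hα,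
    fun β hβ => ?_⟩
  obtain rfl | h := eq_or_ne β α
  · rw [dlog_mul_self, smul_zero]
    exact zero_mem _
  · obtain ⟨c, hc⟩ := linearPoly_dvd_cofactor hβ h
    rw [← linearPoly_mul_cofactor hα, hc, ← mul_assoc, mul_comm, mul_smul, mul_comm, mul_smul,
      ← mul_smul_comm, ← smul_mul_assoc]
    exact Subalgebra.smul_mem _ (mul_mem (smul_dlog_mem (A.form_ne_zero β hβ))
      (smul_dlog_mem (A.form_ne_zero α hα))) _

lemma exists_ι_eq_of_mem_logForms_one {x : RatForms ℓ} (hx : x ∈ A.logForms 1) :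
    ∃ v : RatOneForms ℓ, ι (RatFun ℓ) v = x := by
  have h : x ∈ LinearMap.range (ι (RatFun ℓ)) ^ 1 := (mem_logForms_iff.1 hx).1
  rwa [pow_one] at h

/-- The rational forms whose only pole is a simple logarithmic pole along `ker α`. -/
def logPoleForms (α : Module.Dual ℂ (Fin ℓ → ℂ)) : Submodule (CoordRing ℓ) (RatForms ℓ) :=
  Subalgebra.toSubmodule (polyToRat ℓ).range ⊔
    (Subalgebra.toSubmodule (polyToRat ℓ).range).map (LinearMap.mulLeft (CoordRing ℓ) (dlog α))

lemma mem_logPoleForms {α : Module.Dual ℂ (Fin ℓ → ℂ)} {x : RatForms ℓ} :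
    x ∈ logPoleForms α ↔
      ∃ y ∈ (polyToRat ℓ).range, ∃ z ∈ (polyToRat ℓ).range, y + dlog α * z = x := by
  rw [logPoleForms, Submodule.mem_sup]
  simp only [Subalgebra.mem_toSubmodule, Submodule.mem_map, LinearMap.mulLeft_apply]
  constructor
  · rintro ⟨y, hy, _, ⟨z, hz, rfl⟩, h⟩
    exact ⟨y, hy, z, hz, h⟩
  · rintro ⟨y, hy, z, hz, h⟩
    exact ⟨y, hy, _, ⟨z, hz, rfl⟩, h⟩

/-- The form dα/α has square zero and moves past polynomial forms at the cost of the grading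
involution, so no double pole appears. -/
lemma logPoleForms_mul_mem {α : Module.Dual ℂ (Fin ℓ → ℂ)} {x x' : RatForms ℓ}
    (hx : x ∈ logPoleForms α) (hx' : x' ∈ logPoleForms α) : x * x' ∈ logPoleForms α := by
  obtain ⟨y, hy, z, hz, rfl⟩ := mem_logPoleForms.1 hx
  obtain ⟨y', hy', z', hz', rfl⟩ := mem_logPoleForms.1 hx'
  have hswap : ∀ w ∈ (polyToRat ℓ).range, ∃ w' ∈ (polyToRat ℓ).range,
      w * dlog α = dlog α * w' := by
    rintro _ ⟨w, rfl⟩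
    refine ⟨_, ⟨CliffordAlgebra.involute w, rfl⟩, ?_⟩
    refine Eq.trans ?_ (ι_mul_eq_involute_mul_ι _ _).symm
    congr 1
    refine Eq.trans ?_ (involute_extendForms _).symm
    exact congrArg _ (CliffordAlgebra.involute_involute w).symm
  obtain ⟨u, hu, hyu⟩ := hswap y hy
  obtain ⟨w, hw, hzw⟩ := hswap z hz
  refine mem_logPoleForms.2 ⟨y * y', mul_mem hy hy', u * z' + z * y',
    add_mem (mul_mem hu hz') (mul_mem hz hy'), ?_⟩
  have h1 : y * (dlog α * z') = dlog α * (u * z') := by rw [← mul_assoc, hyu, mul_assoc]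
  have h2 : dlog α * z * (dlog α * z') = 0 := by
    rw [mul_assoc, ← mul_assoc z, hzw, ← mul_assoc, ← mul_assoc, dlog_mul_self, zero_mul, zero_mul]
  rw [add_mul, mul_add y, mul_add (dlog α * z), h1, h2, mul_add (dlog α), mul_assoc (dlog α) z y']
  abel

lemma linearPoly_smul_mem_of_mem_logPoleForms {α : Module.Dual ℂ (Fin ℓ → ℂ)} (hα : α ≠ 0)
    {x : RatForms ℓ} (hx : x ∈ logPoleForms α) : linearPoly α • x ∈ (polyToRat ℓ).range := by
  obtain ⟨y, hy, z, hz, rfl⟩ := mem_logPoleForms.1 hx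
  rw [smul_add, ← smul_mul_assoc]
  exact add_mem (Subalgebra.smul_mem _ hy _) (mul_mem (smul_dlog_mem hα) hz)

lemma linearPoly_smul_dlog_mul_mem_of_mem_logPoleForms {α : Module.Dual ℂ (Fin ℓ → ℂ)}
    (hα : α ≠ 0) {x : RatForms ℓ} (hx : x ∈ logPoleForms α) :
    linearPoly α • (dlog α * x) ∈ (polyToRat ℓ).range := by
  obtain ⟨y, hy, z, hz, rfl⟩ := mem_logPoleForms.1 hx
  rw [mul_add, ← mul_assoc, dlog_mul_self, zero_mul, add_zero, ← smul_mul_assoc]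
  exact mul_mem (smul_dlog_mem hα) hy

end CentralArrangement

end

noncomputable section

open ExteriorAlgebra

namespace CentralArrangement

variable {ℓ : ℕ} {A : CentralArrangement ℓ}

/-- Contraction with a constant vector field c∂ᵢ on which α has value 1; constant coefficients
preserve polynomial forms. -/
lemma exists_contractLeft_mem {α : Module.Dual ℂ (Fin ℓ → ℂ)} (hα : α ≠ 0) :
    ∃ d : Module.Dual (RatFun ℓ) (RatOneForms ℓ), d (differential (linearPoly α)) = 1 ∧
      ∀ x ∈ (polyToRat ℓ).range, CliffordAlgebra.contractLeft
        (Q := (0 : QuadraticForm (RatFun ℓ) (RatOneForms ℓ))) d x ∈ (polyToRat ℓ).range := by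
  obtain ⟨i, hi⟩ : ∃ i, α (Pi.single i 1) ≠ 0 := by
    by_contra! h
    exact hα (LinearMap.pi_ext' fun i => LinearMap.ext_ring (h i))
  set c := (α (Pi.single i 1))⁻¹ with hc
  let d' : Module.Dual (CoordRing ℓ) (Fin ℓ → CoordRing ℓ) :=
    (MvPolynomial.C c : CoordRing ℓ) • LinearMap.proj i
  let d : Module.Dual (RatFun ℓ) (RatOneForms ℓ) :=
    algebraMap (CoordRing ℓ) (RatFun ℓ) (MvPolynomial.C c) • LinearMap.proj i
  have hd : ∀ v, d (fun i => algebraMap (CoordRing ℓ) (RatFun ℓ) (v i)) =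
      algebraMap (CoordRing ℓ) (RatFun ℓ) (d' v) := by
    intro v
    exact (map_mul (algebraMap (CoordRing ℓ) (RatFun ℓ)) _ _).symm
  refine ⟨d, ?_, ?_⟩
  · rw [differential_linearPoly, hd]
    simp only [d', LinearMap.smul_apply, LinearMap.proj_apply, smul_eq_mul, ← map_mul]
    rw [hc, inv_mul_cancel₀ hi, map_one, map_one]
  · rintro _ ⟨w, rfl⟩
    exact ⟨_, (contractLeft_extendForms hd w).symm⟩

/-- Away from the other hyperplanes, a logarithmic form is the sum of a polynomial form and of
`dα / α` times a polynomial form. -/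
lemma cofactor_smul_mem_logPoleForms {p : ℕ} {x : RatForms ℓ} (hx : x ∈ A.logForms p)
    {α : Module.Dual ℂ (Fin ℓ → ℂ)} (hα : α ∈ A.forms) : A.cofactor α • x ∈ logPoleForms α := by
  obtain ⟨-, hy, h2⟩ := mem_logForms_iff.1 hx
  have hz := h2 α hα
  have hα0 := A.form_ne_zero α hα
  obtain ⟨d, hd, hmem⟩ := exists_contractLeft_mem hα0
  set y := A.definingPoly • x with hy'
  set z := A.definingPoly • (dlog α * x) with hz'
  have h3 : ι (RatFun ℓ) (differential (linearPoly α)) * y = linearPoly α • z := by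
    rw [hy', hz', ← smul_dlog hα0, smul_mul_smul_comm, smul_smul]
  -- Contracting dα ∧ y = αz gives y = α·ι_d z + dα ∧ ι_d y. Division by α is the desired
  -- decomposition, as y/α is the cofactor times x.
  have h4 : CliffordAlgebra.contractLeft d
      (ι (RatFun ℓ) (differential (linearPoly α)) * y) =
      d (differential (linearPoly α)) • y - ι (RatFun ℓ) (differential (linearPoly α)) *
        CliffordAlgebra.contractLeft d y :=
    CliffordAlgebra.contractLeft_ι_mul _ _ _
  rw [h3, hd, one_smul, ← algebraMap_smul (RatFun ℓ) (linearPoly α), map_smul,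
    algebraMap_smul] at h4
  refine mem_logPoleForms.2 ⟨_, hmem z hz, _, hmem y hy, ?_⟩
  refine smul_right_cancel_ratForms (linearPoly_ne_zero hα0) ?_
  rw [smul_add, h4, ← smul_mul_assoc, smul_dlog hα0, smul_smul, linearPoly_mul_cofactor hα]
  exact sub_add_cancel _ _

end CentralArrangement

end

/-! ### Testing poles in codimension one; products of logarithmic forms -/

noncomputable section

open ExteriorAlgebra

section LinearForms

variable {ℓ : ℕ}

lemma linearPoly_smul (c : ℂ) (α : Module.Dual ℂ (Fin ℓ → ℂ)) :
    linearPoly (c • α) = MvPolynomial.C c * linearPoly α := by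
  simp only [linearPoly, LinearMap.smul_apply, smul_eq_mul, map_mul, Finset.mul_sum, mul_assoc]

lemma linearPoly_sub (α β : Module.Dual ℂ (Fin ℓ → ℂ)) :
    linearPoly (α - β) = linearPoly α - linearPoly β := by
  simp only [linearPoly, LinearMap.sub_apply, map_sub, sub_mul, Finset.sum_sub_distrib]

lemma linearPoly_injective : Function.Injective (linearPoly (ℓ := ℓ)) := by
  intro α β h
  by_contra hne
  exact linearPoly_ne_zero (sub_ne_zero.2 hne) (by rw [linearPoly_sub, h, sub_self])

lemma totalDegree_linearPoly_le (α : Module.Dual ℂ (Fin ℓ → ℂ)) :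
    (linearPoly α).totalDegree ≤ 1 := by
  refine MvPolynomial.totalDegree_finsetSum_le fun i _ => ?_
  refine (MvPolynomial.totalDegree_mul _ _).trans ?_
  simp

/-- A prime divisor of a linear form is a constant multiple of it. -/
lemma exists_eq_C_mul_of_prime_dvd_linearPoly {α : Module.Dual ℂ (Fin ℓ → ℂ)} (hα : α ≠ 0)
    {q : CoordRing ℓ} (hq : Prime q) (h : q ∣ linearPoly α) :
    ∃ c : ℂ, c ≠ 0 ∧ linearPoly α = MvPolynomial.C c * q := by
  obtain ⟨u, hu⟩ := h
  have hα' := linearPoly_ne_zero hα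
  have hu0 : u ≠ 0 := by
    rintro rfl
    exact hα' (by rw [hu, mul_zero])
  have hdeg := MvPolynomial.totalDegree_mul_of_isDomain hq.ne_zero hu0
  have h1 := totalDegree_linearPoly_le α
  rw [hu] at h1
  have hq1 : q.totalDegree ≠ 0 := by
    intro h0
    rw [MvPolynomial.totalDegree_eq_zero_iff_eq_C] at h0
    refine hq.not_isUnit ?_
    rw [h0]
    refine (isUnit_iff_ne_zero.2 fun h2 => hq.ne_zero ?_).map MvPolynomial.C
    rw [h0, h2, map_zero]
  have hu1 : u.totalDegree = 0 := by omega
  rw [MvPolynomial.totalDegree_eq_zero_iff_eq_C] at hu1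
  refine ⟨u.coeff 0, fun h2 => hu0 ?_, ?_⟩
  · rw [hu1, h2, map_zero]
  · rw [hu, mul_comm, ← hu1]

end LinearForms

namespace CentralArrangement

variable {ℓ : ℕ} {A : CentralArrangement ℓ}

/-- By degree, both forms are constant multiples of q, hence have the same kernel. -/
lemma eq_of_prime_dvd_linearPoly {α β : Module.Dual ℂ (Fin ℓ → ℂ)} (hα : α ∈ A.forms)
    (hβ : β ∈ A.forms) {q : CoordRing ℓ} (hq : Prime q) (hqα : q ∣ linearPoly α)
    (hqβ : q ∣ linearPoly β) : α = β := by
  obtain ⟨c, hc, h1⟩ := exists_eq_C_mul_of_prime_dvd_linearPoly (A.form_ne_zero α hα) hq hqα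
  obtain ⟨d, hd, h2⟩ := exists_eq_C_mul_of_prime_dvd_linearPoly (A.form_ne_zero β hβ) hq hqβ
  have h3 : d • α = c • β := by
    apply linearPoly_injective
    rw [linearPoly_smul, linearPoly_smul, h1, h2]
    ring
  refine A.ker_injOn α hα β hβ ?_
  rw [← LinearMap.ker_smul α d hd, h3, LinearMap.ker_smul β c hc]

/-- Powers of the defining polynomial and of the cofactors of the hyperplanes have no common prime
factor. -/
lemma exists_not_prime_dvd (A : CentralArrangement ℓ) (i j : ℕ) (q : CoordRing ℓ) (hq : Prime q) :
    ∃ r ∈ insert (A.definingPoly ^ i) {r | ∃ α ∈ A.forms, r = A.cofactor α ^ j}, ¬ q ∣ r := by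
  classical
  by_contra! h
  have h1 : q ∣ A.definingPoly := hq.dvd_of_dvd_pow (h _ (Set.mem_insert _ _))
  obtain ⟨α, hα, hqα⟩ := (hq.dvd_finsetProd_iff _).1 h1
  have h2 : q ∣ A.cofactor α :=
    hq.dvd_of_dvd_pow (h _ (Set.mem_insert_of_mem _ ⟨α, hα, rfl⟩))
  obtain ⟨β, hβ, hqβ⟩ := (hq.dvd_finsetProd_iff _).1 h2
  rw [Finset.mem_erase] at hβ
  exact hβ.1 (eq_of_prime_dvd_linearPoly hβ.2 hα hq hqβ hqα)

lemma mem_range_of_forall_smul_mem (A : CentralArrangement ℓ) (i j : ℕ) {x : RatForms ℓ}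
    (h1 : A.definingPoly ^ i • x ∈ (polyToRat ℓ).range)
    (h2 : ∀ α ∈ A.forms, A.cofactor α ^ j • x ∈ (polyToRat ℓ).range) :
    x ∈ (polyToRat ℓ).range := by
  refine mem_range_extendForms_of_forall_prime (A.exists_not_prime_dvd i j) ?_
  rintro r (rfl | ⟨α, hα, rfl⟩)
  · exact h1
  · exact h2 α hα

/-- The rational forms with poles of order at most `n` along `𝓐` that become logarithmic along each
hyperplane after multiplication by the `n`-th power of its cofactor. -/
def poleForms (A : CentralArrangement ℓ) (n : ℕ) : Submodule (CoordRing ℓ) (RatForms ℓ) :=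
  (Subalgebra.toSubmodule (polyToRat ℓ).range).comap
      (LinearMap.lsmul (CoordRing ℓ) (RatForms ℓ) (A.definingPoly ^ n)) ⊓
    ⨅ α ∈ A.forms, (logPoleForms α).comap
      (LinearMap.lsmul (CoordRing ℓ) (RatForms ℓ) (A.cofactor α ^ n))

lemma mem_poleForms {n : ℕ} {x : RatForms ℓ} :
    x ∈ A.poleForms n ↔ A.definingPoly ^ n • x ∈ (polyToRat ℓ).range ∧
      ∀ α ∈ A.forms, A.cofactor α ^ n • x ∈ logPoleForms α := by
  simp [poleForms]

lemma poleForms_mul_mem {m n : ℕ} {x y : RatForms ℓ} (hx : x ∈ A.poleForms m)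
    (hy : y ∈ A.poleForms n) : x * y ∈ A.poleForms (m + n) := by
  rw [mem_poleForms] at hx hy ⊢
  refine ⟨?_, fun α hα => ?_⟩
  · rw [pow_add, ← smul_mul_smul_comm]
    exact mul_mem hx.1 hy.1
  · rw [pow_add, ← smul_mul_smul_comm]
    exact logPoleForms_mul_mem (hx.2 α hα) (hy.2 α hα)

lemma range_le_logPoleForms {α : Module.Dual ℂ (Fin ℓ → ℂ)} {x : RatForms ℓ}
    (hx : x ∈ (polyToRat ℓ).range) : x ∈ logPoleForms α :=
  mem_logPoleForms.2 ⟨x, hx, 0, zero_mem _, by rw [mul_zero, add_zero]⟩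

lemma logForms_le_poleForms (p : ℕ) : A.logForms p ≤ A.poleForms 1 := by
  intro x hx
  rw [mem_poleForms, pow_one]
  refine ⟨(mem_logForms_iff.1 hx).2.1, fun α hα => ?_⟩
  rw [pow_one]
  exact cofactor_smul_mem_logPoleForms hx hα

/-- Each factor adds one to the exponent. The base case starts at 1 rather than 0 so that the
exponent is positive, as `mem_logForms_of_mem_poleForms` requires. -/
lemma logForms_one_pow_le_poleForms (p : ℕ) : A.logForms 1 ^ p ≤ A.poleForms (p + 1) := by
  induction p with
  | zero =>
    rw [pow_zero, Submodule.one_le, mem_poleForms, zero_add]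
    exact ⟨Subalgebra.smul_mem _ (one_mem _) _,
      fun α hα => range_le_logPoleForms (Subalgebra.smul_mem _ (one_mem _) _)⟩
  | succ p ih =>
    rw [pow_succ, Submodule.mul_le]
    intro x hx y hy
    exact poleForms_mul_mem (ih hx) (logForms_le_poleForms 1 hy)

/-- The apparent high pole order is spurious: powers of f and of the cofactors have no common prime
factor, and after multiplication by a cofactor power only a simple logarithmic pole remains. -/
lemma mem_logForms_of_mem_poleForms {p n : ℕ} {x : RatForms ℓ}
    (hx : x ∈ ⋀[RatFun ℓ]^p (RatOneForms ℓ)) (hn : x ∈ A.poleForms (n + 1)) :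
    x ∈ A.logForms p := by
  rw [mem_poleForms] at hn
  refine mem_logForms_iff.2 ⟨hx, ?_, fun α hα => ?_⟩
  · refine A.mem_range_of_forall_smul_mem n n ?_ fun β hβ => ?_
    · rw [smul_smul, ← pow_succ]
      exact hn.1
    · have h1 : A.cofactor β ^ n * A.definingPoly = linearPoly β * A.cofactor β ^ (n + 1) := by
        rw [← linearPoly_mul_cofactor hβ]; ring
      rw [smul_smul, h1, mul_smul]
      exact linearPoly_smul_mem_of_mem_logPoleForms (A.form_ne_zero β hβ) (hn.2 β hβ)
  · have hα0 := A.form_ne_zero α hα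
    refine A.mem_range_of_forall_smul_mem (n + 1) (n + 1) ?_ fun β hβ => ?_
    · rw [smul_comm, ← mul_smul_comm, ← smul_mul_assoc]
      exact mul_mem (definingPoly_smul_dlog_mem hα) hn.1
    · obtain rfl | h := eq_or_ne β α
      · rw [smul_comm, ← mul_smul_comm, ← linearPoly_mul_cofactor hβ, mul_comm, mul_smul]
        exact Subalgebra.smul_mem _
          (linearPoly_smul_dlog_mul_mem_of_mem_logPoleForms hα0 (hn.2 β hβ)) _
      -- For β ≠ α the product αβ divides f: the factor α clears dα/α and β clears the remaining
      -- pole of x along ker β.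
      · obtain ⟨c, hc⟩ := linearPoly_dvd_cofactor hα (Ne.symm h)
        have h1 : A.definingPoly = c * linearPoly α * linearPoly β := by
          rw [← linearPoly_mul_cofactor hβ, hc]; ring
        rw [smul_comm, ← mul_smul_comm, h1, mul_smul, ← mul_smul_comm, ← smul_mul_assoc, mul_smul]
        exact mul_mem (Subalgebra.smul_mem _ (smul_dlog_mem hα0) _)
          (linearPoly_smul_mem_of_mem_logPoleForms (A.form_ne_zero β hβ) (hn.2 β hβ))

/-- Exterior products of logarithmic forms are logarithmic. -/
lemma logForms_one_pow_le (p : ℕ) : A.logForms 1 ^ p ≤ A.logForms p := by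
  intro x hx
  refine mem_logForms_of_mem_poleForms ?_ (logForms_one_pow_le_poleForms p hx)
  induction p generalizing x with
  | zero =>
    rw [pow_zero, Submodule.mem_one] at hx
    obtain ⟨r, rfl⟩ := hx
    change _ ∈ LinearMap.range (ι (RatFun ℓ)) ^ 0
    rw [pow_zero, IsScalarTower.algebraMap_apply (CoordRing ℓ) (RatFun ℓ)]
    exact Submodule.algebraMap_mem _
  | succ p ih =>
    rw [pow_succ'] at hx
    induction hx using Submodule.mul_induction_on' with
    | mem_mul_mem m hm y hy =>
      obtain ⟨v, rfl⟩ := exists_ι_eq_of_mem_logForms_one hm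
      exact ι_mul_mem_exteriorPower v (ih hy)
    | add a _ b _ ha hb => exact add_mem ha hb

end CentralArrangement

end

/-! ### Extending maps on logarithmic 1-forms to rational forms -/

noncomputable section

open ExteriorAlgebra CategoryTheory

lemma range_extendForms_le {R K : Type*} [CommRing R] [Field K] [Algebra R K] {n : ℕ}
    {S : Subalgebra R (ExteriorAlgebra K (Fin n → K))}
    (h : ∀ i, ι K (Pi.single i (1 : K)) ∈ S) : (extendForms R K n).range ≤ S := by
  rintro _ ⟨x, rfl⟩
  change extendForms R K n x ∈ S
  induction x using ExteriorAlgebra.induction with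
  | algebraMap r => rw [AlgHom.commutes]; exact S.algebraMap_mem r
  | ι v =>
    have hv : v = ∑ i, v i • Pi.single i 1 := by
      ext j
      simp [Finset.sum_apply, Pi.single_apply]
    rw [hv]
    simp only [map_sum, map_smul, extendForms_ι_single]
    exact sum_mem fun i _ => S.smul_mem (h i) _
  | mul a b ha hb => rw [map_mul]; exact mul_mem ha hb
  | add a b ha hb => rw [map_add]; exact add_mem ha hb

section Wedge

variable {ℓ : ℕ} {N : Submodule (CoordRing ℓ) (RatForms ℓ)} (hN : ∀ x ∈ N, x * x = 0)

/-- The algebra homomorphism `⋀_R N → ⋀_K K^ℓ` given by exterior products. -/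
def wedgeHom : ExteriorAlgebra (CoordRing ℓ) N →ₐ[CoordRing ℓ] RatForms ℓ :=
  ExteriorAlgebra.lift (CoordRing ℓ) ⟨N.subtype, fun x => hN x x.2⟩

@[simp]
lemma wedgeHom_ι (m : N) : wedgeHom hN (ι (CoordRing ℓ) m) = m :=
  lift_ι_apply _ _ _ m

lemma range_wedgeMap (p : ℕ) : LinearMap.range (wedgeMap N hN p) = N ^ p := by
  have h1 : LinearMap.range (wedgeMap N hN p) =
      (⋀[CoordRing ℓ]^p N).map (wedgeHom hN).toLinearMap := by
    exact (LinearMap.range_comp _ _).trans (by rw [Submodule.range_subtype]; rfl)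
  have h2 : (LinearMap.range (ι (CoordRing ℓ) (M := N))).map (wedgeHom hN).toLinearMap = N := by
    rw [← LinearMap.range_comp]
    have : (wedgeHom hN).toLinearMap ∘ₗ ι (CoordRing ℓ) (M := N) = N.subtype :=
      LinearMap.ext fun m => wedgeHom_ι hN m
    rw [this, Submodule.range_subtype]
  rw [h1]
  exact (Submodule.map_pow _ _ p).trans (by rw [h2])

lemma mem_range_wedgeHom {x : RatForms ℓ} (hx : x ∈ N) : x ∈ (wedgeHom hN).range :=
  ⟨ι _ ⟨x, hx⟩, wedgeHom_ι hN _⟩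

end Wedge

namespace CentralArrangement

variable {ℓ : ℕ} (A : CentralArrangement ℓ)

/-- The algebra homomorphism `⋀ Ω¹(𝓐) → ⋀_K K^ℓ` given by exterior products. -/
abbrev logWedgeHom : ExteriorAlgebra (CoordRing ℓ) (A.logForms 1) →ₐ[CoordRing ℓ] RatForms ℓ :=
  wedgeHom (N := A.logForms 1) fun _ hx => A.logForms_one_mul_self hx

lemma range_polyToRat_le_range_logWedgeHom : (polyToRat ℓ).range ≤ A.logWedgeHom.range :=
  range_extendForms_le fun i => mem_range_wedgeHom _ (ι_single_mem_logForms i)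

lemma logPoleForms_le_range_logWedgeHom {α : Module.Dual ℂ (Fin ℓ → ℂ)} (hα : α ∈ A.forms)
    {x : RatForms ℓ} (hx : x ∈ logPoleForms α) : x ∈ A.logWedgeHom.range := by
  obtain ⟨y, hy, z, hz, rfl⟩ := mem_logPoleForms.1 hx
  exact add_mem (A.range_polyToRat_le_range_logWedgeHom hy)
    (mul_mem (mem_range_wedgeHom _ (dlog_mem_logForms hα))
      (A.range_polyToRat_le_range_logWedgeHom hz))

instance finite_logForms_one : Module.Finite (CoordRing ℓ) (A.logForms 1) := by
  have h1 : ∀ x ∈ A.logForms 1, A.definingPoly • x ∈ polyOneForms ℓ := by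
    intro x hx
    have h2 : A.definingPoly • x ∈ polyForms ℓ 1 := hx.1
    rwa [polyForms, pow_one] at h2
  have : Module.Finite (CoordRing ℓ) (polyOneForms ℓ) :=
    Module.Finite.iff_fg.2 (Submodule.fg_span (Set.finite_range _))
  refine Module.Finite.of_injective ((LinearMap.lsmul (CoordRing ℓ) (RatForms ℓ)
    A.definingPoly).restrict h1) fun x y hxy => Subtype.ext ?_
  exact smul_right_cancel_ratForms A.definingPoly_ne_zero (congrArg Subtype.val hxy)

lemma hasProjectiveDimensionLE_logForms_one (h : A.IsTame) :
    HasProjectiveDimensionLE (ModuleCat.of (CoordRing ℓ) (A.logForms 1)) 1 := by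
  obtain hℓ | hℓ := Nat.eq_zero_or_pos ℓ
  -- For ℓ = 0 tameness says nothing in degree one, but there are no nonzero 1-forms.
  · subst hℓ
    have h1 : Subsingleton (A.logForms 1) := by
      refine ⟨fun x y => Subtype.ext ?_⟩
      obtain ⟨v, hv⟩ := exists_ι_eq_of_mem_logForms_one x.2
      obtain ⟨w, hw⟩ := exists_ι_eq_of_mem_logForms_one y.2
      rw [← hv, ← hw, Subsingleton.elim v w]
    have : Projective (ModuleCat.of (CoordRing 0) (A.logForms 1)) := by
      rw [← IsProjective.iff_projective]
      infer_instance
    infer_instance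
  · exact h 1 hℓ

variable {A}

section Extend

variable {n : ℕ} (g : A.logForms 1 →ₗ[CoordRing ℓ] (Fin n → CoordRing ℓ))
  (h : (Fin n → CoordRing ℓ) →ₗ[CoordRing ℓ] A.logForms 1)

/-- The `K`-linear extension of a linear map from logarithmic `1`-forms to a free module. -/
def extendHom : RatOneForms ℓ →ₗ[RatFun ℓ] (Fin n → RatFun ℓ) :=
  (Pi.basisFun (RatFun ℓ) (Fin ℓ)).constr (RatFun ℓ) fun i j =>
    algebraMap (CoordRing ℓ) (RatFun ℓ) (g ⟨_, ι_single_mem_logForms i⟩ j)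

lemma extendHom_single (i : Fin ℓ) : extendHom g (Pi.single i 1) =
    fun j => algebraMap (CoordRing ℓ) (RatFun ℓ) (g ⟨_, ι_single_mem_logForms i⟩ j) := by
  conv_lhs => rw [extendHom, ← Pi.basisFun_apply, Module.Basis.constr_basis]

/-- Both sides agree on the dxᵢ, hence on polynomial 1-forms such as f·m, and f can be cancelled
over the field. -/
lemma map_extendHom_coe (m : A.logForms 1) :
    ExteriorAlgebra.map (extendHom g) m = extendForms _ _ _ (ι (CoordRing ℓ) (g m)) := by
  have hsmul : ∀ (a : CoordRing ℓ) (x : RatForms ℓ),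
      ExteriorAlgebra.map (extendHom g) (a • x) = a • ExteriorAlgebra.map (extendHom g) x :=
    fun a x => by rw [← algebraMap_smul (RatFun ℓ) a x, map_smul, algebraMap_smul]
  have h1 : ∀ x ∈ polyOneForms ℓ, ∀ hx : x ∈ A.logForms 1, ExteriorAlgebra.map (extendHom g) x =
      extendForms _ (RatFun ℓ) _ (ι (CoordRing ℓ) (g ⟨x, hx⟩)) := by
    intro x hx'
    have hle : polyOneForms ℓ ≤ A.logForms 1 := by
      have := A.polyForms_le_logForms 1
      rwa [polyForms, pow_one] at this
    induction hx' using Submodule.span_induction with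
    | mem x hx' =>
      obtain ⟨i, rfl⟩ := hx'
      intro hx
      simp only [differential_X, map_apply_ι, extendHom_single, extendForms_ι]
    | zero =>
      intro hx
      rw [map_zero, show (⟨0, hx⟩ : A.logForms 1) = 0 from rfl, map_zero, map_zero, map_zero]
    | add x y hx1 hy1 ihx ihy =>
      intro hx
      rw [map_add, ihx (hle hx1), ihy (hle hy1), ← map_add, ← map_add, ← map_add]
      rfl
    | smul a x hx1 ih =>
      intro hx
      have : (⟨a • x, hx⟩ : A.logForms 1) = a • ⟨x, hle hx1⟩ := rfl
      rw [this, hsmul, map_smul, map_smul, map_smul, ih]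
  have h2 : A.definingPoly • (m : RatForms ℓ) ∈ polyOneForms ℓ := by
    have h2 : A.definingPoly • (m : RatForms ℓ) ∈ polyForms ℓ 1 := m.2.1
    rwa [polyForms, pow_one] at h2
  have h3 := h1 _ h2 (A.definingPoly • m).2
  have h4 : (⟨A.definingPoly • (m : RatForms ℓ), (A.definingPoly • m).2⟩ : A.logForms 1) =
    A.definingPoly • m := rfl
  rw [h4, hsmul, map_smul, map_smul, map_smul] at h3
  refine smul_right_injective _ (r := algebraMap (CoordRing ℓ) (RatFun ℓ) A.definingPoly)
    (by simpa using A.definingPoly_ne_zero) ?_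
  simpa only [algebraMap_smul] using h3

lemma map_extendHom_logWedgeHom (t : ExteriorAlgebra (CoordRing ℓ) (A.logForms 1)) :
    ExteriorAlgebra.map (extendHom g) (A.logWedgeHom t) =
      extendForms _ _ _ (ExteriorAlgebra.map g t) := by
  have : ((ExteriorAlgebra.map (extendHom g)).restrictScalars (CoordRing ℓ)).comp A.logWedgeHom =
      (extendForms (CoordRing ℓ) (RatFun ℓ) n).comp (ExteriorAlgebra.map g) := by
    ext m
    have := map_extendHom_coe g m
    simpa using this
  exact DFunLike.congr_fun this t

lemma exists_extend :
    ∃ hK : (Fin n → RatFun ℓ) →ₗ[RatFun ℓ] RatOneForms ℓ, ∀ v,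
      ι (RatFun ℓ) (hK fun i => algebraMap (CoordRing ℓ) (RatFun ℓ) (v i)) = (h v : RatForms ℓ) := by
  choose u hu using fun i => exists_ι_eq_of_mem_logForms_one (h (Pi.single i 1)).2
  refine ⟨(Pi.basisFun (RatFun ℓ) (Fin n)).constr (RatFun ℓ) u, fun v => ?_⟩
  have hv : v = ∑ i, v i • Pi.single i 1 := by
    ext j
    simp [Finset.sum_apply, Pi.single_apply]
  rw [Module.Basis.constr_apply_fintype]
  conv_rhs => rw [hv]
  simp only [map_sum, map_smul, Submodule.coe_sum, Submodule.coe_smul, hu]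
  refine Finset.sum_congr rfl fun i _ => ?_
  rw [← algebraMap_smul (RatFun ℓ)]
  rfl

end Extend

end CentralArrangement

end

/-! ### Kernel and cokernel of the exterior product -/

noncomputable section

open ExteriorAlgebra CategoryTheory

lemma Ideal.exists_pow_smul_mem {R M : Type*} [CommRing R] [AddCommGroup M] [Module R M]
    {I : Ideal R} (hI : I.FG) {N : Submodule R M} {x : M}
    (h : ∀ a ∈ I, ∃ j : ℕ, a ^ j • x ∈ N) : ∃ m, ∀ a ∈ I ^ m, a • x ∈ N := by
  obtain ⟨m, hm⟩ := Ideal.exists_pow_le_of_le_radical_of_fg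
    (J := N.comap (LinearMap.toSpanSingleton R M x)) (I := I) (fun a ha => h a ha) hI
  exact ⟨m, fun a ha => hm ha⟩

lemma Ideal.exists_pow_smul_eq_zero {R M : Type*} [CommRing R] [AddCommGroup M] [Module R M]
    {I : Ideal R} (hI : I.FG) {x : M} (h : ∀ a ∈ I, ∃ j : ℕ, a ^ j • x = 0) :
    ∃ m, ∀ a ∈ I ^ m, a • x = 0 := by
  simpa only [Submodule.mem_bot] using Ideal.exists_pow_smul_mem (N := ⊥) hI h

/-- A linear map from an exterior power of `M` is an isomorphism onto a torsion-free module as soon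
as kernel and cokernel are annihilated by powers of the multiplications on `M` that factor through
free modules. -/
theorem injective_and_range_eq_of_factor {ℓ k p : ℕ} {M V : Type} [AddCommGroup M]
    [Module (CoordRing ℓ) M] [Module.Finite (CoordRing ℓ) M] [AddCommGroup V]
    [Module (CoordRing ℓ) V]
    (hpd : HasProjectiveDimensionLE (ModuleCat.of (CoordRing ℓ) M) 1)
    (hcodim : (k : ℕ∞) < specCodim (Module.freeLocus (CoordRing ℓ) M)ᶜ) (hp : p < k)
    (hV : ∀ r : CoordRing ℓ, r ≠ 0 → ∀ x y : V, r • x = r • y → x = y)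
    {φ : ⋀[CoordRing ℓ]^p M →ₗ[CoordRing ℓ] V} {L : Submodule (CoordRing ℓ) V}
    (hL : LinearMap.range φ ≤ L)
    (hker : ∀ (n : ℕ) (g : M →ₗ[CoordRing ℓ] (Fin n → CoordRing ℓ))
      (h : (Fin n → CoordRing ℓ) →ₗ[CoordRing ℓ] M) (a : CoordRing ℓ), (∀ m, h (g m) = a • m) →
      ∀ t, φ t = 0 → a ^ p • t = 0)
    (hcoker : ∀ (n : ℕ) (g : M →ₗ[CoordRing ℓ] (Fin n → CoordRing ℓ))
      (h : (Fin n → CoordRing ℓ) →ₗ[CoordRing ℓ] M) (a : CoordRing ℓ), (∀ m, h (g m) = a • m) →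
      ∀ x ∈ L, a ^ p • x ∈ LinearMap.range φ) :
    Function.Injective φ ∧ LinearMap.range φ = L := by
  obtain ⟨I, hI, hfac, hdepth⟩ := exists_ideal_extDepth_exteriorPower hpd hcodim
  have hIfg : I.FG := IsNoetherian.noetherian I
  have hd := hdepth p hp.le
  have hinj : Function.Injective φ := by
    rw [← LinearMap.ker_eq_bot, LinearMap.ker_eq_bot']
    intro t ht
    obtain ⟨m, hm⟩ := Ideal.exists_pow_smul_eq_zero hIfg (x := t) fun a ha => by
      obtain ⟨n, g, h, hgh⟩ := hfac a ha
      exact ⟨p, hker n g h a hgh t ht⟩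
    exact (hd.mono (by omega)).eq_zero_of_pow hm
  refine ⟨hinj, le_antisymm hL fun x hx => ?_⟩
  obtain ⟨m, hm⟩ := Ideal.exists_pow_smul_mem (N := LinearMap.range φ) hIfg (x := x)
    fun a ha => by
      obtain ⟨n, g, h, hgh⟩ := hfac a ha
      exact ⟨p, hcoker n g h a hgh x hx⟩
  obtain ⟨b, hb, hb0⟩ := Submodule.exists_mem_ne_zero_of_ne_bot hI
  -- The strict inequality p < k enters here: the image of φ, isomorphic to ⋀^p M, has depth k + 1 -
  -- p ≥ 2.
  exact ExtDepth.mem_of_pow_smul_mem (fun y hy => hV b hb0 y 0 ((hy b hb).trans (smul_zero b).symm))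
    ((hd.mono (by omega)).of_equiv (LinearEquiv.ofInjective _ hinj)) hm

namespace CentralArrangement

variable {ℓ : ℕ} (A : CentralArrangement ℓ)

section Factor

variable {A} {n : ℕ} {g : A.logForms 1 →ₗ[CoordRing ℓ] (Fin n → CoordRing ℓ)}
  {h : (Fin n → CoordRing ℓ) →ₗ[CoordRing ℓ] A.logForms 1} {a : CoordRing ℓ}

/-- The kernel of the exterior product is annihilated by the multiplications factoring through
free modules. -/
lemma pow_smul_eq_zero_of_logWedge_eq_zero (hgh : ∀ m, h (g m) = a • m) {p : ℕ}
    {t : ⋀[CoordRing ℓ]^p (A.logForms 1)} (ht : A.logWedge p t = 0) : a ^ p • t = 0 := by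
  have h1 : A.logWedgeHom t = 0 := ht
  have h2 := map_extendHom_logWedgeHom g (t : ExteriorAlgebra _ _)
  rw [h1, map_zero] at h2
  -- Forms on R^n embed in forms over K, so ⋀g already kills t; applying ⋀h turns this into a^p t =
  -- 0.
  have h3 : ExteriorAlgebra.map g t = 0 := extendForms_injective (h2.symm.trans (map_zero _).symm)
  have h4 : h ∘ₗ g = a • LinearMap.id := LinearMap.ext hgh
  have h5 : a ^ p • (t : ExteriorAlgebra (CoordRing ℓ) (A.logForms 1)) = 0 := by
    rw [← map_smul_id_of_mem_exteriorPower a t.2, ← h4,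
      ← ExteriorAlgebra.map_comp_map, AlgHom.comp_apply, h3, map_zero]
  exact Subtype.ext h5

/-- Products of logarithmic 1-forms have integral image. Both fω and every cofactor times ω are sums
of such products, and these multipliers share no prime factor. -/
lemma map_extendHom_mem_range {p : ℕ} {ω : RatForms ℓ} (hω : ω ∈ A.logForms p) :
    ExteriorAlgebra.map (extendHom g) ω ∈ (extendForms (CoordRing ℓ) (RatFun ℓ) n).range := by
  have hsmul : ∀ (r : CoordRing ℓ) (x : RatForms ℓ),
      ExteriorAlgebra.map (extendHom g) (r • x) = r • ExteriorAlgebra.map (extendHom g) x :=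
    fun r x => by rw [← algebraMap_smul (RatFun ℓ) r x, map_smul, algebraMap_smul]
  have h1 : ∀ x ∈ A.logWedgeHom.range,
      ExteriorAlgebra.map (extendHom g) x ∈ (extendForms (CoordRing ℓ) (RatFun ℓ) n).range := by
    rintro _ ⟨t, rfl⟩
    exact ⟨_, (map_extendHom_logWedgeHom g t).symm⟩
  refine mem_range_extendForms_of_forall_prime (A.exists_not_prime_dvd 1 1) ?_
  rintro r (rfl | ⟨α, hα, rfl⟩)
  · rw [pow_one, ← hsmul]
    exact h1 _ (A.range_polyToRat_le_range_logWedgeHom (mem_logForms_iff.1 hω).2.1)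
  · rw [pow_one, ← hsmul]
    exact h1 _ (A.logPoleForms_le_range_logWedgeHom hα (cofactor_smul_mem_logPoleForms hω hα))

lemma comp_extendHom (hgh : ∀ m, h (g m) = a • m) {hK : (Fin n → RatFun ℓ) →ₗ[RatFun ℓ]
    RatOneForms ℓ} (hhK : ∀ v, ι (RatFun ℓ) (hK fun i => algebraMap (CoordRing ℓ) (RatFun ℓ) (v i)) =
      (h v : RatForms ℓ)) :
    hK ∘ₗ extendHom g = algebraMap (CoordRing ℓ) (RatFun ℓ) a • LinearMap.id := by
  refine (Pi.basisFun (RatFun ℓ) (Fin ℓ)).ext fun i => ?_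
  have h5 : ι (RatFun ℓ) (hK (extendHom g (Pi.single i 1))) =
      ι (RatFun ℓ) (algebraMap (CoordRing ℓ) (RatFun ℓ) a • Pi.single i 1) := by
    rw [extendHom_single, hhK, hgh, map_smul, algebraMap_smul]
    rfl
  rw [Pi.basisFun_apply]
  exact (ExteriorAlgebra.ι_inj _ _ _).1 h5

lemma range_extendForms_le_comap {hK : (Fin n → RatFun ℓ) →ₗ[RatFun ℓ] RatOneForms ℓ}
    (hhK : ∀ v, ι (RatFun ℓ) (hK fun i => algebraMap (CoordRing ℓ) (RatFun ℓ) (v i)) =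
      (h v : RatForms ℓ)) :
    (extendForms (CoordRing ℓ) (RatFun ℓ) n).range ≤
      A.logWedgeHom.range.comap ((ExteriorAlgebra.map hK).restrictScalars (CoordRing ℓ)) := by
  refine range_extendForms_le fun i => ?_
  have h4 := hhK (Pi.single i 1)
  have h5 : (fun j => algebraMap (CoordRing ℓ) (RatFun ℓ)
      ((Pi.single i 1 : Fin n → CoordRing ℓ) j)) = Pi.single i 1 := by
    ext j
    by_cases hj : j = i
    · subst hj; simp
    · simp [hj]
  rw [h5] at h4
  refine (Subalgebra.mem_comap _ _ _).2 ?_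
  rw [AlgHom.restrictScalars_apply, map_apply_ι, h4]
  exact mem_range_wedgeHom _ (h _).2

/-- The cokernel of the exterior product is annihilated by the multiplications factoring through
free modules. -/
lemma pow_smul_mem_range_logWedge (hgh : ∀ m, h (g m) = a • m) {p : ℕ} {ω : RatForms ℓ}
    (hω : ω ∈ A.logForms p) : a ^ p • ω ∈ LinearMap.range (A.logWedge p) := by
  have hdeg := (mem_logForms_iff.1 hω).1
  obtain ⟨hK, hhK⟩ := exists_extend h
  have h1 : a ^ p • ω ∈ ⋀[RatFun ℓ]^p (RatOneForms ℓ) := by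
    rw [← algebraMap_smul (RatFun ℓ)]
    exact Submodule.smul_mem _ _ hdeg
  have h2 : a ^ p • ω ∈ A.logWedgeHom.range := by
    -- The extension of g makes ω integral and that of h sends integral forms to products of
    -- logarithmic 1-forms; the composite multiplies ω by a^p.
    have h3 := (Subalgebra.mem_comap _ _ _).1
      (range_extendForms_le_comap hhK (map_extendHom_mem_range (g := g) hω))
    rwa [AlgHom.restrictScalars_apply, ← AlgHom.comp_apply, ExteriorAlgebra.map_comp_map,
      comp_extendHom hgh hhK, map_smul_id_of_mem_exteriorPower _ hdeg, ← map_pow,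
      algebraMap_smul] at h3
  obtain ⟨t, ht⟩ := h2
  change A.logWedgeHom t = a ^ p • ω at ht
  rw [← ht] at h1
  obtain ⟨t', ht', h4⟩ := exists_mem_exteriorPower_map_eq (φ := A.logWedgeHom) (fun m => by
    rw [wedgeHom_ι]
    exact exists_ι_eq_of_mem_logForms_one m.2) h1
  exact ⟨⟨t', ht'⟩, h4.trans ht⟩

end Factor

theorem logWedge_injective_and_range {k : ℕ} (htame : A.IsTame)
    (hcodim : (k : ℕ∞) < specCodim A.nonFreeLocus) {p : ℕ} (hp : p < k) :
    Function.Injective (A.logWedge p) ∧ LinearMap.range (A.logWedge p) = A.logForms p :=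
  injective_and_range_eq_of_factor (A.hasProjectiveDimensionLE_logForms_one htame) hcodim hp
    (fun _ hr _ _ h => smul_right_cancel_ratForms hr h)
    ((range_wedgeMap _ p).le.trans (logForms_one_pow_le p))
    (fun _ _ _ _ hgh _ ht => pow_smul_eq_zero_of_logWedge_eq_zero hgh ht)
    (fun _ _ _ _ hgh _ hω => pow_smul_mem_range_logWedge hgh hω)

end CentralArrangement

end

/-! ### The Euler field and relative logarithmic forms -/

noncomputable section

open ExteriorAlgebra

section Euler

variable {ℓ : ℕ}

/-- The value of a rational `1`-form on the Euler field. -/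
def eulerDual (ℓ : ℕ) : Module.Dual (RatFun ℓ) (RatOneForms ℓ) :=
  ∑ i, algebraMap (CoordRing ℓ) (RatFun ℓ) (MvPolynomial.X i) •
    (LinearMap.proj i : RatOneForms ℓ →ₗ[RatFun ℓ] RatFun ℓ)

lemma eulerContraction_ι (v : RatOneForms ℓ) :
    eulerContraction ℓ (ι (RatFun ℓ) v) = algebraMap (RatFun ℓ) _ (eulerDual ℓ v) :=
  CliffordAlgebra.contractLeft_ι _ _ _

lemma eulerContraction_algebraMap (c : RatFun ℓ) :
    eulerContraction ℓ (algebraMap (RatFun ℓ) _ c) = 0 :=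
  CliffordAlgebra.contractLeft_algebraMap _ _ _

lemma eulerContraction_ι_mul (v : RatOneForms ℓ) (x : RatForms ℓ) :
    eulerContraction ℓ (ι (RatFun ℓ) v * x) =
      eulerDual ℓ v • x - ι (RatFun ℓ) v * eulerContraction ℓ x :=
  CliffordAlgebra.contractLeft_ι_mul _ _ _

lemma eulerContraction_smul (r : CoordRing ℓ) (x : RatForms ℓ) :
    eulerContraction ℓ (r • x) = r • eulerContraction ℓ x :=
  ((eulerContraction ℓ).restrictScalars (CoordRing ℓ)).map_smul r x

/-- Euler's formula for linear forms. -/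
lemma eulerDual_differential_linearPoly (α : Module.Dual ℂ (Fin ℓ → ℂ)) :
    eulerDual ℓ (differential (linearPoly α)) =
      algebraMap (CoordRing ℓ) (RatFun ℓ) (linearPoly α) := by
  rw [differential_linearPoly]
  simp only [eulerDual, linearPoly, LinearMap.sum_apply, LinearMap.smul_apply,
    LinearMap.proj_apply, smul_eq_mul, map_sum, map_mul]
  exact Finset.sum_congr rfl fun i _ => mul_comm _ _

lemma eulerContraction_mem_range {x : RatForms ℓ} (hx : x ∈ (polyToRat ℓ).range) :
    eulerContraction ℓ x ∈ (polyToRat ℓ).range := by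
  obtain ⟨w, rfl⟩ := hx
  have hd : ∀ v : Fin ℓ → CoordRing ℓ,
      eulerDual ℓ (fun i => algebraMap (CoordRing ℓ) (RatFun ℓ) (v i)) =
      algebraMap (CoordRing ℓ) (RatFun ℓ)
        ((∑ i, (MvPolynomial.X i : CoordRing ℓ) • LinearMap.proj i :
          Module.Dual (CoordRing ℓ) (Fin ℓ → CoordRing ℓ)) v) := by
    intro v
    simp only [eulerDual, LinearMap.sum_apply, LinearMap.smul_apply, LinearMap.proj_apply,
      smul_eq_mul, map_sum, map_mul]
  exact ⟨_, (contractLeft_extendForms hd w).symm⟩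

end Euler

lemma injective_comp_map_of_retraction {R M M' B : Type*} [CommRing R] [AddCommGroup M]
    [Module R M] [AddCommGroup M'] [Module R M'] [Ring B] [Algebra R B] {f : M →ₗ[R] M'}
    {ρ : M' →ₗ[R] M} (hρ : ρ ∘ₗ f = LinearMap.id) {φ : ExteriorAlgebra R M' →ₐ[R] B} {p : ℕ}
    (h : Function.Injective (φ.toLinearMap ∘ₗ (⋀[R]^p M').subtype)) :
    Function.Injective ((φ.comp (ExteriorAlgebra.map f)).toLinearMap ∘ₗ (⋀[R]^p M).subtype) := by
  have h1 : (φ.comp (ExteriorAlgebra.map f)).toLinearMap ∘ₗ (⋀[R]^p M).subtype =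
      (φ.toLinearMap ∘ₗ (⋀[R]^p M').subtype) ∘ₗ exteriorPower.map p f := by
    refine LinearMap.ext fun t => ?_
    exact congrArg φ (exteriorPower.coe_map p f t).symm
  rw [h1]
  exact h.comp (exteriorPower.map_injective ρ hρ)

set_option maxHeartbeats 800000 in
lemma wedgeMap_injective_of_retraction {ℓ : ℕ} {N N' : Submodule (CoordRing ℓ) (RatForms ℓ)}
    (hle : N ≤ N') {ρ : N' →ₗ[CoordRing ℓ] N} (hρ : ∀ x, ρ (Submodule.inclusion hle x) = x)
    {hN : ∀ x ∈ N, x * x = 0} {hN' : ∀ x ∈ N', x * x = 0} {p : ℕ}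
    (h : Function.Injective (wedgeMap N' hN' p)) : Function.Injective (wedgeMap N hN p) := by
  have h1 : (wedgeHom hN').comp (ExteriorAlgebra.map (Submodule.inclusion hle)) = wedgeHom hN := by
    ext m
    simp
  have h2 := injective_comp_map_of_retraction (f := Submodule.inclusion hle) (LinearMap.ext hρ)
    (φ := wedgeHom hN') h
  rw [h1] at h2
  exact h2

namespace CentralArrangement

variable {ℓ : ℕ} {A : CentralArrangement ℓ}

lemma eulerDual_smul_differential {α : Module.Dual ℂ (Fin ℓ → ℂ)} (hα : α ≠ 0) :
    eulerDual ℓ ((algebraMap (CoordRing ℓ) (RatFun ℓ) (linearPoly α))⁻¹ •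
      differential (linearPoly α)) = 1 := by
  have h : algebraMap (CoordRing ℓ) (RatFun ℓ) (linearPoly α) ≠ 0 := by
    simpa using linearPoly_ne_zero hα
  rw [map_smul, eulerDual_differential_linearPoly, smul_eq_mul, inv_mul_cancel₀ h]

lemma eulerContraction_dlog {α : Module.Dual ℂ (Fin ℓ → ℂ)} (hα : α ≠ 0) :
    eulerContraction ℓ (dlog α) = 1 := by
  rw [dlog, eulerContraction_ι, eulerDual_smul_differential hα, map_one]

lemma eulerContraction_dlog_mul {α : Module.Dual ℂ (Fin ℓ → ℂ)} (hα : α ≠ 0) (x : RatForms ℓ) :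
    eulerContraction ℓ (dlog α * x) = x - dlog α * eulerContraction ℓ x := by
  rw [dlog, eulerContraction_ι_mul, eulerDual_smul_differential hα, one_smul]

lemma mem_relLogForms_iff {p : ℕ} {x : RatForms ℓ} :
    x ∈ A.relLogForms p ↔ x ∈ A.logForms p ∧ eulerContraction ℓ x = 0 := Iff.rfl

/-- The value of a logarithmic `1`-form on the Euler field is a polynomial. -/
lemma exists_eulerContraction_eq {x : RatForms ℓ} (hx : x ∈ A.logForms 1) :
    ∃ r : CoordRing ℓ, eulerContraction ℓ x = algebraMap (CoordRing ℓ) _ r := by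
  obtain ⟨v, rfl⟩ := exists_ι_eq_of_mem_logForms_one hx
  obtain ⟨-, hf, hlog⟩ := mem_logForms_iff.1 hx
  have h1 : eulerContraction ℓ (ι (RatFun ℓ) v) ∈ (polyToRat ℓ).range := by
    refine A.mem_range_of_forall_smul_mem 1 1 ?_ fun α hα => ?_
    · rw [pow_one, ← eulerContraction_smul]
      exact eulerContraction_mem_range hf
    · have hα0 := A.form_ne_zero α hα
      -- Since ι_χ(dα/α ∧ x) = x - (dα/α)ι_χx, subtracting from fx leaves the polynomial form
      -- cofactor · ι_χx · dα; contracting with d then strips off dα.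
      have h2 := eulerContraction_mem_range (hlog α hα)
      rw [eulerContraction_smul, eulerContraction_dlog_mul hα0, smul_sub] at h2
      have h3 := sub_mem hf h2
      rw [sub_sub_cancel, ← linearPoly_mul_cofactor hα, mul_comm, mul_smul, ← smul_mul_assoc,
        smul_dlog hα0] at h3
      obtain ⟨d, hd, hmem⟩ := exists_contractLeft_mem hα0
      have h4 := hmem _ h3
      have h5 : ∀ c : RatFun ℓ, CliffordAlgebra.contractLeft
          (Q := (0 : QuadraticForm (RatFun ℓ) (RatOneForms ℓ))) d
          (ι (RatFun ℓ) (differential (linearPoly α)) * algebraMap (RatFun ℓ) _ c) =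
          algebraMap (RatFun ℓ) _ c := by
        intro c
        refine (CliffordAlgebra.contractLeft_ι_mul _ _ _).trans ?_
        rw [hd, one_smul, CliffordAlgebra.contractLeft_algebraMap, mul_zero, sub_zero]
      rw [← algebraMap_smul (RatFun ℓ) (A.cofactor α), map_smul, eulerContraction_ι, h5,
        algebraMap_smul] at h4
      rwa [pow_one, eulerContraction_ι]
  have h2 : eulerContraction ℓ (ι (RatFun ℓ) v) ∈ polyForms ℓ 0 := by
    refine mem_polyForms_iff.2 ⟨h1, ?_⟩
    rw [eulerContraction_ι]
    change _ ∈ LinearMap.range (ι (RatFun ℓ)) ^ 0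
    rw [pow_zero]
    exact Submodule.algebraMap_mem _
  rw [polyForms, pow_zero, Submodule.mem_one] at h2
  obtain ⟨r, hr⟩ := h2
  exact ⟨r, hr.symm⟩

/-- As ι_χ(dα/α) = 1 and ι_χx is a polynomial, this is the projection of Ω¹(𝓐) onto Ω¹₀(𝓐) along
R·dα/α. -/
lemma sub_eulerContraction_mul_dlog_mem {α : Module.Dual ℂ (Fin ℓ → ℂ)} (hα : α ∈ A.forms)
    {x : RatForms ℓ} (hx : x ∈ A.logForms 1) :
    x - eulerContraction ℓ x * dlog α ∈ A.relLogForms 1 := by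
  obtain ⟨r, hr⟩ := exists_eulerContraction_eq hx
  rw [hr, ← Algebra.smul_def]
  refine mem_relLogForms_iff.2 ⟨sub_mem hx (Submodule.smul_mem _ _ (dlog_mem_logForms hα)), ?_⟩
  rw [map_sub, eulerContraction_smul, eulerContraction_dlog (A.form_ne_zero α hα), hr,
    Algebra.algebraMap_eq_smul_one, sub_self]

lemma eulerContraction_mul_eq_zero {m x : RatForms ℓ} (hm : m ∈ A.relLogForms 1)
    (hx : eulerContraction ℓ x = 0) : eulerContraction ℓ (m * x) = 0 := by
  obtain ⟨v, rfl⟩ := exists_ι_eq_of_mem_logForms_one (mem_relLogForms_iff.1 hm).1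
  have h1 := (mem_relLogForms_iff.1 hm).2
  rw [eulerContraction_ι, map_eq_zero_iff _ (algebraMap_leftInverse _).injective] at h1
  rw [eulerContraction_ι_mul, h1, hx, zero_smul, mul_zero, sub_zero]

lemma eulerContraction_eq_zero_of_mem_pow {p : ℕ} {x : RatForms ℓ}
    (hx : x ∈ A.relLogForms 1 ^ p) : eulerContraction ℓ x = 0 := by
  induction hx using Submodule.pow_induction_on_left' with
  | algebraMap r =>
    rw [IsScalarTower.algebraMap_apply (CoordRing ℓ) (RatFun ℓ), eulerContraction_algebraMap]
  | add x y i hx hy ihx ihy => rw [map_add, ihx, ihy, add_zero]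
  | mem_mul m hm i x hx ih => exact eulerContraction_mul_eq_zero hm ih

lemma exists_eq_add_dlog_mul_of_mem_pow {α : Module.Dual ℂ (Fin ℓ → ℂ)} (hα : α ∈ A.forms)
    {p : ℕ} {x : RatForms ℓ} (hx : x ∈ A.logForms 1 ^ p) :
    ∃ y ∈ A.relLogForms 1 ^ p, ∃ z, eulerContraction ℓ z = 0 ∧ x = y + dlog α * z := by
  induction hx using Submodule.pow_induction_on_left' with
  | algebraMap r =>
    refine ⟨algebraMap _ _ r, ?_, 0, map_zero _, by rw [mul_zero, add_zero]⟩
    rw [pow_zero]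
    exact Submodule.algebraMap_mem _
  | add x x' i hx hx' ih ih' =>
    obtain ⟨y, hy, z, hz, rfl⟩ := ih
    obtain ⟨y', hy', z', hz', rfl⟩ := ih'
    refine ⟨y + y', add_mem hy hy', z + z', by rw [map_add, hz, hz', add_zero], ?_⟩
    rw [mul_add]
    abel
  | mem_mul m hm i x hx ih =>
    obtain ⟨y, hy, z, hz, rfl⟩ := ih
    obtain ⟨r, hr⟩ := exists_eulerContraction_eq hm
    have h0 := sub_eulerContraction_mul_dlog_mem hα hm
    rw [hr, ← Algebra.smul_def] at h0
    obtain ⟨m0, hm0, rfl⟩ : ∃ m0 ∈ A.relLogForms 1, m = m0 + r • dlog α :=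
      ⟨_, h0, (sub_add_cancel _ _).symm⟩
    -- Obtained by expanding (m0 + r dα/α)(y + dα/α ∧ z), where m0 anticommutes with dα/α.
    refine ⟨m0 * y, ?_, r • y - m0 * z, ?_, ?_⟩
    · rw [pow_succ']
      exact Submodule.mul_mem_mul hm0 hy
    · rw [map_sub, eulerContraction_smul, eulerContraction_eq_zero_of_mem_pow hy,
        eulerContraction_mul_eq_zero hm0 hz, smul_zero, sub_zero]
    · have h1 : m0 * dlog α = -(dlog α * m0) := by
        obtain ⟨v, rfl⟩ := exists_ι_eq_of_mem_logForms_one (mem_relLogForms_iff.1 hm0).1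
        exact eq_neg_of_add_eq_zero_left (ι_add_mul_swap _ _)
      rw [add_mul, mul_add, mul_add, ← mul_assoc m0, h1, smul_mul_assoc, smul_mul_assoc,
        ← mul_assoc (dlog α) (dlog α), dlog_mul_self, zero_mul, smul_zero, add_zero, mul_sub,
        mul_smul_comm, neg_mul, mul_assoc]
      abel

/-- Contraction of y + dα/α ∧ z returns z, so a relative form has z = 0 and is a sum of products of
relative 1-forms. -/
lemma relLogForms_one_pow_eq {α : Module.Dual ℂ (Fin ℓ → ℂ)} (hα : α ∈ A.forms) {p : ℕ}
    (h : A.logForms 1 ^ p = A.logForms p) : A.relLogForms 1 ^ p = A.relLogForms p := by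
  refine le_antisymm (fun x hx => ?_) fun x hx => ?_
  · refine mem_relLogForms_iff.2 ⟨?_, eulerContraction_eq_zero_of_mem_pow hx⟩
    exact logForms_one_pow_le p (pow_le_pow_left' (inf_le_left : A.relLogForms 1 ≤ A.logForms 1) p hx)
  · obtain ⟨hx1, hx2⟩ := mem_relLogForms_iff.1 hx
    rw [← h] at hx1
    obtain ⟨y, hy, z, hz, rfl⟩ := exists_eq_add_dlog_mul_of_mem_pow hα hx1
    rw [map_add, eulerContraction_eq_zero_of_mem_pow hy,
      eulerContraction_dlog_mul (A.form_ne_zero α hα), hz, mul_zero, sub_zero, zero_add] at hx2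
    rwa [hx2, mul_zero, add_zero]

/-- The projection along dα/α splits the inclusion Ω¹₀(𝓐) ⊆ Ω¹(𝓐), so the inclusion stays injective
on exterior powers. -/
lemma relLogWedge_injective {α : Module.Dual ℂ (Fin ℓ → ℂ)} (hα : α ∈ A.forms) {p : ℕ}
    (h : Function.Injective (A.logWedge p)) : Function.Injective (A.relLogWedge p) := by
  have hle : A.relLogForms 1 ≤ A.logForms 1 := inf_le_left
  let ρ : A.logForms 1 →ₗ[CoordRing ℓ] A.relLogForms 1 :=
    (LinearMap.id - LinearMap.mulRight (CoordRing ℓ) (dlog α) ∘ₗ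
      (eulerContraction ℓ).restrictScalars (CoordRing ℓ)).restrict
        fun x hx => sub_eulerContraction_mul_dlog_mem hα hx
  have hρ : ∀ x, ρ (Submodule.inclusion hle x) = x := by
    refine fun x => Subtype.ext ?_
    change (x : RatForms ℓ) - eulerContraction ℓ x * dlog α = x
    rw [(mem_relLogForms_iff.1 x.2).2, zero_mul, sub_zero]
  exact wedgeMap_injective_of_retraction hle hρ h

variable (A) in
lemma range_logWedge (p : ℕ) : LinearMap.range (A.logWedge p) = A.logForms 1 ^ p :=
  range_wedgeMap _ p

variable (A) in
lemma range_relLogWedge (p : ℕ) : LinearMap.range (A.relLogWedge p) = A.relLogForms 1 ^ p :=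
  range_wedgeMap _ p

lemma relLogForms_eq_logForms_zero (A : CentralArrangement 0) (p : ℕ) :
    A.relLogForms p = A.logForms p := by
  refine inf_eq_left.2 fun x _ => ?_
  change eulerContraction 0 x = 0
  rw [eulerContraction, Finset.univ_eq_empty, Finset.sum_empty, map_zero, LinearMap.zero_apply]

lemma relLogWedge_injective_zero (A : CentralArrangement 0) {p : ℕ}
    (h : Function.Injective (A.logWedge p)) : Function.Injective (A.relLogWedge p) :=
  wedgeMap_injective_of_retraction (A.relLogForms_eq_logForms_zero 1).le
    (ρ := Submodule.inclusion (A.relLogForms_eq_logForms_zero 1).ge) (fun _ => rfl) h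

set_option maxHeartbeats 800000 in
variable (A) in
theorem relLogWedge_injective_and_range (hA : 0 < ℓ → A.forms.Nonempty) {p : ℕ}
    (h : Function.Injective (A.logWedge p) ∧ LinearMap.range (A.logWedge p) = A.logForms p) :
    Function.Injective (A.relLogWedge p) ∧
      LinearMap.range (A.relLogWedge p) = A.relLogForms p := by
  have hpow : A.logForms 1 ^ p = A.logForms p := (A.range_logWedge p).symm.trans h.2
  rw [A.range_relLogWedge]
  obtain hℓ | hℓ := Nat.eq_zero_or_pos ℓ
  -- For ℓ = 0 no hyperplane is available, but the Euler field is zero and every form is relative.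
  · subst hℓ
    refine ⟨A.relLogWedge_injective_zero h.1, ?_⟩
    rw [A.relLogForms_eq_logForms_zero, A.relLogForms_eq_logForms_zero, hpow]
  · obtain ⟨α, hα⟩ := hA hℓ
    exact ⟨relLogWedge_injective hα h.1, relLogForms_one_pow_eq hα hpow⟩

end CentralArrangement

theorem mainTheorem5 (ℓ : ℕ) (A : CentralArrangement ℓ) (hA : 0 < ℓ → A.forms.Nonempty)
    (k : ℕ) (htame : A.IsTame) (hcodim : (k : ℕ∞) < specCodim A.nonFreeLocus) :
    ∀ p < k,
      (Function.Injective (A.relLogWedge p) ∧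
        LinearMap.range (A.relLogWedge p) = A.relLogForms p) ∧
      (Function.Injective (A.logWedge p) ∧
        LinearMap.range (A.logWedge p) = A.logForms p) := by
  intro p hp
  have h := A.logWedge_injective_and_range htame hcodim hp
  exact ⟨A.relLogWedge_injective_and_range hA h, h⟩

end
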